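/- Let $\Theta\subseteq\mathbb R$ and let $\theta$ be a fixed interior point of $\Theta$ (a multivariate parameter is treated componentwise). Consider the latent variable model $X_k\sim f_\theta$ i.i.d. on $\mathbb R^n$, $Y_k\mid X_k\sim g_\theta(\cdot\mid X_k)$, with likelihood $p(y_{1:T}\mid\theta)=\prod_{k=1}^T p(y_k\mid\theta)$, where $p(y\mid\theta)=\int f_\theta(x)g_\theta(y\mid x)\,dx$. Let $q_\theta(x\mid y)$ be an importance density on $\mathbb R^n$ with $q_\theta(x\mid y)>0$ for almost every $x$ with $f_\theta(x)g_\theta(y\mid x)>0$, simulated as $X=\gamma(\theta,y,V)$ with $V\sim\mathcal N(0_p,I_p)$. Put $$\omega_\theta(y,u)=\frac{g_\theta(y\mid X)f_\theta(X)}{q_\theta(X\mid y)},\quad X=\gamma(\theta,y,u),\qquad \varpi_\theta(y,u)=\frac{\omega_\theta(y,u)}{p(y\mid\theta)},$$ $$\widehat p(y_{1:T}\mid\theta,\mathbf u)=\prod_{k=1}^T\frac1N\sum_{i=1}^N\omega_\theta(y_k,\mathbf u_{k,i}),\qquad \varepsilon_N(y_k,\mathbf u_k;\theta)=\frac1{\sqrt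 N}\sum_{i=1}^N\{\varpi_\theta(y_k,\mathbf u_{k,i})-1\}.$$ Let $\beta>0$ and $N=\lceil\beta T\rceil$. Let $Y_1,Y_2,\dots$ be i.i.d. with law $\mu$ and, for each $T$, given $\mathcal F^T=\sigma(Y_{1:T})$, let $\mathbf U=(\mathbf U_{k,i})_{k\le T,\,i\le N}$ have the conditional law $\overline\pi(\cdot\mid\theta)$ with density $\widehat p(Y_{1:T}\mid\theta,\mathbf u)/p(Y_{1:T}\mid\theta)$ with respect to the standard normal distribution on $\mathbb R^{TNp}$. Assume that for $\mu$-almost every $y$ one has $0<p(y\mid t)<\infty$ for all $t$ near $\theta$; that $t\mapsto\varpi_t(y,u)$ is differentiable at $\theta$ for almost every $(y,u)$ under $\mu\otimes\mathcal N(0_p,I_p)$; that for $\mu$-almost every $y$ the gradient $\nabla_\theta\varpi_\theta(y,\cdot)$ is $\mathcal N(0_p,I_p)$-integrable and derivative and expectation can be swapped, i.e. $\nabla_\theta\mathbb E[\varpi_\theta(y,V)]=\mathbb E[\nabla_\theta\varpi_\theta(y,V)]$ for $V\sim\mathcal N(0_p,I_p)$; and that $$\limsup_{T\to\infty}\mathbb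 E\big[(\nabla_\theta\varepsilon_N(Y_T,\mathbf U_T;\theta))^4\big]<\infty,\qquad \limsup_{T\to\infty}\mathbb E\big[(\varepsilon_N(Y_T,\mathbf U_T;\theta))^4\big]<\infty .$$ Then $\mathbb E_{Y_1\sim\mu,\ \mathbf U_{1,1}\sim\mathcal N(0_p,I_p)}[\{\nabla_\theta\varpi_\theta(Y_1,\mathbf U_{1,1})\}^2]<\infty$ and, as $T\to\infty$, almost surely the conditional law given $\mathcal F^T$ of the log-likelihood gradient error converges weakly to a centred normal law: $$\nabla_\theta\log\frac{\widehat p(Y_{1:T}\mid\theta,\mathbf U)}{p(Y_{1:T}\mid\theta)}\,\Big|\,\mathcal F^T\ \Rightarrow\ \mathcal N\Big(0,\ \beta^{-1}\,\mathbb E_{Y_1\sim\mu,\ \mathbf U_{1,1}\sim\mathcal N(0_p,I_p)}\big[\{\nabla_\theta\varpi_\theta(Y_1,\mathbf U_{1,1})\}^2\big]\Big).$$ Moreover the error is integrable for every $T$, and its conditional mean given $\mathcal F^T$ tends to $0$ almost surely, i.e. the bias is asymptotically zero. -/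

import Mathlib

open MeasureTheory ProbabilityTheory Filter Topology

/-- A latent variable model with a scalar parameter `θ ∈ Θ`, together with an importance
distribution for the latent variable:
`X ∼ f θ` on `ℝⁿ` (density with respect to Lebesgue measure), `Y | X = x ∼ g θ · x` (density with
respect to the reference measure `ν` on the observation space), and an importance density
`q θ y` on `ℝⁿ` which is simulated as `γ θ y V` with `V ∼ 𝓝(0_p, I_p)`. -/
structure LatentVariableModel (n p : ℕ) (S : Type*) [MeasurableSpace S] (ν : Measure S)
    (Θ : Set ℝ) where
  /-- `f θ x` is the density of the latent variable. -/
  f : ℝ → EuclideanSpace ℝ (Fin n) → ℝ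
  /-- `g θ y x` is the conditional density of the observation `y` given the latent `x`. -/
  g : ℝ → S → EuclideanSpace ℝ (Fin n) → ℝ
  /-- `q θ y x` is the importance density of the latent `x`, given the observation `y`. -/
  q : ℝ → S → EuclideanSpace ℝ (Fin n) → ℝ
  /-- `γ θ y v` maps a standard normal variable to a draw from `q θ y`. -/
  γ : ℝ → S → EuclideanSpace ℝ (Fin p) → EuclideanSpace ℝ (Fin n)
  f_measurable : ∀ θ ∈ Θ, Measurable (f θ)
  f_nonneg : ∀ θ ∈ Θ, ∀ x, 0 ≤ f θ x
  f_density : ∀ θ ∈ Θ, ∫⁻ x, ENNReal.ofReal (f θ x) = 1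
  g_measurable : ∀ θ ∈ Θ, Measurable fun z : S × EuclideanSpace ℝ (Fin n) => g θ z.1 z.2
  g_nonneg : ∀ θ ∈ Θ, ∀ y x, 0 ≤ g θ y x
  g_density : ∀ θ ∈ Θ, ∀ x, ∫⁻ y, ENNReal.ofReal (g θ y x) ∂ν = 1
  q_measurable : ∀ θ ∈ Θ, Measurable fun z : S × EuclideanSpace ℝ (Fin n) => q θ z.1 z.2
  q_nonneg : ∀ θ ∈ Θ, ∀ y x, 0 ≤ q θ y x
  /-- Importance sampling is well posed: `q θ y` charges the support of `f θ · g θ y`. -/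
  q_support : ∀ θ ∈ Θ, ∀ y, ∀ᵐ x, q θ y x = 0 → f θ x * g θ y x = 0
  γ_measurable : ∀ θ ∈ Θ, Measurable fun z : S × EuclideanSpace ℝ (Fin p) => γ θ z.1 z.2
  /-- `γ θ y V ∼ q θ y` for `V ∼ 𝓝(0_p, I_p)`. -/
  γ_law : ∀ θ ∈ Θ, ∀ y, (stdGaussian (EuclideanSpace ℝ (Fin p))).map (γ θ y) =
    volume.withDensity fun x => ENNReal.ofReal (q θ y x)

namespace LatentVariableModel

variable {n p : ℕ} {S : Type*} [MeasurableSpace S] {ν : Measure S} {Θ : Set ℝ}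

/-- The likelihood `p(y | θ) = ∫ f_θ(x) g_θ(y | x) dx` of a single observation. -/
noncomputable def lik (M : LatentVariableModel n p S ν Θ) (θ : ℝ) (y : S) : ℝ :=
  ∫ x, M.f θ x * M.g θ y x

/-- The importance weight `ω_θ(y, u) = g_θ(y | X) f_θ(X) / q_θ(X | y)` with `X = γ(θ, u)`. -/
noncomputable def weight (M : LatentVariableModel n p S ν Θ) (θ : ℝ) (y : S)
    (u : EuclideanSpace ℝ (Fin p)) : ℝ :=
  M.g θ y (M.γ θ y u) * M.f θ (M.γ θ y u) / M.q θ y (M.γ θ y u)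

/-- The normalized importance weight `ϖ_θ(y, u) = ω_θ(y, u) / p(y | θ)`. -/
noncomputable def nweight (M : LatentVariableModel n p S ν Θ) (θ : ℝ) (y : S)
    (u : EuclideanSpace ℝ (Fin p)) : ℝ :=
  M.weight θ y u / M.lik θ y

/-- The gradient `∇_θ ϖ_θ(y, u)`. -/
noncomputable def gradNweight (M : LatentVariableModel n p S ν Θ) (θ : ℝ) (y : S)
    (u : EuclideanSpace ℝ (Fin p)) : ℝ :=
  deriv (fun t => M.nweight t y u) θ

/-- The estimator `p̂(y | θ, u) = N⁻¹ ∑ᵢ ω_θ(y, uᵢ)` of the likelihood of one observation. -/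
noncomputable def likEst (M : LatentVariableModel n p S ν Θ) {N : ℕ} (θ : ℝ) (y : S)
    (u : Fin N → EuclideanSpace ℝ (Fin p)) : ℝ :=
  (1 / (N : ℝ)) * ∑ i, M.weight θ y (u i)

/-- The likelihood `p(y_{1:T} | θ) = ∏ₖ p(yₖ | θ)`. -/
noncomputable def fullLik (M : LatentVariableModel n p S ν Θ) {T : ℕ} (θ : ℝ)
    (y : Fin T → S) : ℝ :=
  ∏ k, M.lik θ (y k)

/-- The estimator `p̂(y_{1:T} | θ, u) = ∏ₖ p̂(yₖ | θ, uₖ)` of the likelihood. -/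
noncomputable def fullLikEst (M : LatentVariableModel n p S ν Θ) {T N : ℕ} (θ : ℝ)
    (y : Fin T → S) (u : Fin T → Fin N → EuclideanSpace ℝ (Fin p)) : ℝ :=
  ∏ k, M.likEst θ (y k) (u k)

/-- The error in the log-likelihood gradient,
`∇_θ log (p̂(y_{1:T} | θ, u) / p(y_{1:T} | θ))`. -/
noncomputable def gradLogError (M : LatentVariableModel n p S ν Θ) {T N : ℕ} (θ : ℝ)
    (y : Fin T → S) (u : Fin T → Fin N → EuclideanSpace ℝ (Fin p)) : ℝ :=
  deriv (fun t => Real.log (M.fullLikEst t y u / M.fullLik t y)) θ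

/-- The conditional distribution `π̄(· | θ)` of the auxiliary variables for the data `y_{1:T}`: it
has density `p̂(y_{1:T} | θ, u) / p(y_{1:T} | θ)` with respect to the standard normal
distribution on `(ℝᵖ)^(T N)`. -/
noncomputable def auxLaw (M : LatentVariableModel n p S ν Θ) {T : ℕ} (N : ℕ) (θ : ℝ)
    (y : Fin T → S) : Measure (Fin T → Fin N → EuclideanSpace ℝ (Fin p)) :=
  (Measure.pi fun _ : Fin T => Measure.pi fun _ : Fin N =>
      stdGaussian (EuclideanSpace ℝ (Fin p))).withDensity
    fun u => ENNReal.ofReal (M.fullLikEst θ y u / M.fullLik θ y)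

/-- The normalized error `ε_N(y, u; θ) = N^{-1/2} ∑ᵢ (ϖ_θ(y, uᵢ) - 1)`. -/
noncomputable def eps (M : LatentVariableModel n p S ν Θ) {N : ℕ} (θ : ℝ) (y : S)
    (u : Fin N → EuclideanSpace ℝ (Fin p)) : ℝ :=
  (1 / √(N : ℝ)) * ∑ i, (M.nweight θ y (u i) - 1)

/-- The gradient `∇_θ ε_N(y, u; θ)`. -/
noncomputable def gradEps (M : LatentVariableModel n p S ν Θ) {N : ℕ} (θ : ℝ) (y : S)
    (u : Fin N → EuclideanSpace ℝ (Fin p)) : ℝ :=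
  deriv (fun t => M.eps t y u) θ

end LatentVariableModel

/-- The number of importance samples per observation, `N = ⌈β T⌉`. -/
noncomputable def numSamples (β : ℝ) (T : ℕ) : ℕ := ⌈β * (T : ℝ)⌉₊

/-- The first `T` observations `Y_{1:T}`; the sequence `Y 0, Y 1, …` lists `Y₁, Y₂, …`. -/
def obs {Ω S : Type*} (Y : ℕ → Ω → S) (T : ℕ) (ω : Ω) : Fin T → S := fun k => Y k ω

/-! ### Elementary inequalities for the characteristic function -/

/-! Given the data, the density defining the auxiliary law factorises over observations, so the
blocks are independent, block `k` having density `W = blockAvg w` with respect to `γ^N`. The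
logarithmic derivative of a product is a sum, hence the error is a sum of independent scores `D / W`
with `D = blockAvg d`, where `w` is the normalized weight and `d` its gradient. The tilt cancels the
denominator: the conditional mean of a score is `E[D] = 0`, exactly and for every `T`.

The same cancellation drives the limit law. The characteristic function of one score is `φ(s) = E[W
exp(i s D / W)]`, now under the untilted `γ^N`. Since `E[W] = 1`, `E[D] = 0` and `N E[D²] = E[d²]`,
a second-order expansion gives `N (φ(s) - 1) → -s² E[d²] / 2`. The remainder
(`norm_tilted_exp_sub_le`) is a square of normalized sums times a bounded cutoff that vanishes as `W
→ 1` and `D → 0`; uniform integrability of these squares (`exists_integral_normSum_sq_mul_le`) sends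
it to zero using second moments only. A law of large numbers for dominated arrays
(`tendsto_average_of_dominated`) sums the expansions along the data, `T / N → β⁻¹` supplies the
variance, and `norm_prod_sub_exp_sum_le` passes from the sum of `φ - 1` to the product of the `φ`.
Lévy's continuity theorem concludes.

The second moments come from the fourth moments under the tilted law at one single sample size: a
block with at least two draws contains a draw that can be integrated out while another one carries
the weight (`lintegral_sq_le_of_fourth`). -/

lemma norm_exp_I_mul_sub_quadratic_le (x : ℝ) :
    ‖Complex.exp (Complex.I * x) - 1 - Complex.I * x + (x : ℂ) ^ 2 / 2‖ ≤
      3 * x ^ 2 * min 1 |x| := by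
  rcases le_total |x| 1 with hx | hx
  · rw [min_eq_right hx]
    have h := Complex.exp_bound (x := Complex.I * x) (by simpa using hx) (n := 3) (by norm_num)
    have e : Complex.exp (Complex.I * x) - ∑ m ∈ Finset.range 3,
        (Complex.I * x) ^ m / (m.factorial : ℂ) =
        Complex.exp (Complex.I * x) - 1 - Complex.I * x + (x : ℂ) ^ 2 / 2 := by
      simp only [Finset.sum_range_succ, Finset.sum_range_zero, Nat.factorial]
      push_cast
      linear_combination (-(x : ℂ) ^ 2 / 2) * Complex.I_sq
    rw [e] at h
    refine h.trans ?_
    have : ‖Complex.I * (x : ℂ)‖ = |x| := by simp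
    rw [this]
    have h2 : |x| ^ 3 = x ^ 2 * |x| := by rw [← sq_abs x]; ring
    rw [h2]
    norm_num [Nat.factorial]
    nlinarith [mul_nonneg (sq_nonneg x) (abs_nonneg x)]
  · rw [min_eq_left hx]
    have h1 : ‖Complex.exp (Complex.I * x) - 1‖ ≤ |x| := by
      simpa using Real.norm_exp_I_mul_ofReal_sub_one_le (x := x)
    have h2 : ‖Complex.I * (x : ℂ)‖ = |x| := by simp
    have h3 : ‖(x : ℂ) ^ 2 / 2‖ = x ^ 2 / 2 := by simp
    calc _ ≤ ‖Complex.exp (Complex.I * x) - 1‖ + ‖Complex.I * (x : ℂ)‖ + ‖(x : ℂ) ^ 2 / 2‖ :=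
          (norm_add_le _ _).trans (by gcongr; exact norm_sub_le _ _)
      _ ≤ |x| + |x| + x ^ 2 / 2 := by rw [h2, h3]; gcongr
      _ ≤ _ := by nlinarith [sq_abs x]

/-- The constant in the second-order expansion of a tilted characteristic function. -/
noncomputable def tiltConst (s : ℝ) : ℝ := 4 * |s| + 13 * s ^ 2 * (1 + |s|)

lemma tiltConst_nonneg (s : ℝ) : 0 ≤ tiltConst s := by unfold tiltConst; positivity

/-- With `n = √N` this is the pointwise expansion behind the limit theorem. The bound is quadratic
in `n * D` and `n * (W - 1)` times a bounded factor, rather than cubic, so that second moments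
suffice after integration. -/
lemma norm_tilted_exp_sub_le {n W D : ℝ} (s : ℝ) (hW : 0 ≤ W) (hn : 0 ≤ n) :
    ‖(n ^ 2 : ℂ) * (W * Complex.exp (Complex.I * ((s * (D / W) : ℝ) : ℂ)) - W
        - Complex.I * ((s * D : ℝ) : ℂ)) + (s : ℂ) ^ 2 * ((n * D : ℝ) : ℂ) ^ 2 / 2‖ ≤
      tiltConst s * (((n * D) ^ 2 + (n * (W - 1)) ^ 2) * (min 1 |W - 1| + min 1 |D|)) := by
  set B := min 1 |W - 1| + min 1 |D| with hB
  have hB1 : min 1 |W - 1| ≤ B := le_add_of_nonneg_right (by positivity)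
  have hB2 : min 1 |D| ≤ B := le_add_of_nonneg_left (by positivity)
  have hB0 : 0 ≤ B := by positivity
  set a := n * D with ha
  set b := n * (W - 1) with hb
  have hs := abs_nonneg s
  -- For `W < 1/2` the cutoff is at least `1/2` and `n ≤ 2 |b|`, so first-order bounds are enough.
  -- For `W ≥ 1/2` division by `W` costs at most a factor `2` and Taylor expansion applies.
  rcases lt_or_ge W (1 / 2) with hW2 | hW2
  · have hB3 : 1 / 2 ≤ B := by
      refine le_trans ?_ hB1
      rw [abs_of_neg (by linarith)]
      exact le_min (by norm_num) (by linarith)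
    have h1 : ‖(W : ℂ) * Complex.exp (Complex.I * ((s * (D / W) : ℝ) : ℂ)) - W‖ ≤ |s| * |D| := by
      rw [show (W : ℂ) * Complex.exp (Complex.I * ((s * (D / W) : ℝ) : ℂ)) - W =
        W * (Complex.exp (Complex.I * ((s * (D / W) : ℝ) : ℂ)) - 1) by ring, norm_mul]
      have := Real.norm_exp_I_mul_ofReal_sub_one_le (x := s * (D / W))
      rw [Complex.norm_real, Real.norm_of_nonneg hW]
      rcases hW.eq_or_lt with h0 | h0
      · rw [← h0]; simp; positivity
      · calc _ ≤ W * ‖s * (D / W)‖ := by gcongr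
          _ = |s| * |D| := by
            rw [Real.norm_eq_abs, abs_mul, abs_div, abs_of_pos h0]; field_simp
    have h2 : ‖Complex.I * ((s * D : ℝ) : ℂ)‖ = |s| * |D| := by
      rw [norm_mul, Complex.norm_real, Real.norm_eq_abs, abs_mul]; simp
    have h3 : ‖(s : ℂ) ^ 2 * (a : ℂ) ^ 2 / 2‖ = s ^ 2 * a ^ 2 / 2 := by simp
    have h4 : ‖(n ^ 2 : ℂ)‖ = n ^ 2 := by simp
    have h5 : n * |D| = |a| := by rw [ha, abs_mul, abs_of_nonneg hn]
    have h6 : n ≤ 2 * |b| := by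
      rw [hb, abs_mul, abs_of_nonneg hn, abs_of_neg (by linarith)]
      nlinarith
    have h7 : n ^ 2 * |D| ≤ a ^ 2 + b ^ 2 := by
      calc n ^ 2 * |D| = n * |a| := by rw [← h5]; ring
        _ ≤ 2 * |b| * |a| := by gcongr
        _ ≤ _ := by nlinarith [sq_nonneg (|a| - |b|), sq_abs a, sq_abs b]
    calc _ ≤ ‖(n ^ 2 : ℂ)‖ * (‖(W : ℂ) * Complex.exp (Complex.I * ((s * (D / W) : ℝ) : ℂ)) - W‖
          + ‖Complex.I * ((s * D : ℝ) : ℂ)‖) + ‖(s : ℂ) ^ 2 * (a : ℂ) ^ 2 / 2‖ := by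
            refine (norm_add_le _ _).trans ?_
            rw [norm_mul]
            gcongr
            exact norm_sub_le _ _
      _ ≤ n ^ 2 * (|s| * |D| + |s| * |D|) + s ^ 2 * a ^ 2 / 2 := by
            rw [h2, h3, h4]; gcongr
      _ = 2 * |s| * (n ^ 2 * |D|) + s ^ 2 * a ^ 2 / 2 := by ring
      _ ≤ 2 * |s| * (a ^ 2 + b ^ 2) + s ^ 2 * (a ^ 2 + b ^ 2) / 2 := by
            gcongr; nlinarith [sq_nonneg b]
      _ = (4 * |s| + s ^ 2) * ((a ^ 2 + b ^ 2) * (1 / 2)) := by ring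
      _ ≤ tiltConst s * ((a ^ 2 + b ^ 2) * B) := by
            have : 4 * |s| + s ^ 2 ≤ tiltConst s := by
              unfold tiltConst; nlinarith [mul_nonneg (sq_nonneg s) hs, sq_nonneg s]
            have := tiltConst_nonneg s
            gcongr
  · have hW0 : 0 < W := by linarith
    set x := s * (D / W) with hx
    -- The expansion in `x = s D / W` produces `n² W x² / 2 = s² a² / (2 W)`; replacing it by `s² a²
    -- / 2` leaves the factor `1 - 1 / W`, which the cutoff controls.
    have key : (n ^ 2 : ℂ) * (W * Complex.exp (Complex.I * (x : ℂ)) - W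
        - Complex.I * ((s * D : ℝ) : ℂ)) + (s : ℂ) ^ 2 * (a : ℂ) ^ 2 / 2 =
        ((n ^ 2 * W : ℝ) : ℂ) * (Complex.exp (Complex.I * x) - 1 - Complex.I * x + (x : ℂ) ^ 2 / 2)
        + ((s ^ 2 * a ^ 2 / 2 * (1 - 1 / W) : ℝ) : ℂ) := by
      have hWc : (W : ℂ) ≠ 0 := by exact_mod_cast hW0.ne'
      rw [hx, ha]; push_cast; field_simp; ring
    rw [key]
    have h1 := norm_exp_I_mul_sub_quadratic_le x
    have h2 : |1 - 1 / W| ≤ 2 * B := by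
      have : |1 - 1 / W| = |W - 1| / W := by
        rw [show 1 - 1 / W = (W - 1) / W by field_simp, abs_div, abs_of_pos hW0]
      refine le_trans ?_ (mul_le_mul_of_nonneg_left hB1 zero_le_two)
      rw [this, div_le_iff₀ hW0]
      rcases le_total 1 |W - 1| with h | h
      · rw [min_eq_left h]
        rcases abs_cases (W - 1) with h' | h' <;> linarith
      · rw [min_eq_right h]
        nlinarith [abs_nonneg (W - 1)]
    have h3 : x ^ 2 * (n ^ 2 * W) ≤ 2 * (s ^ 2 * a ^ 2) := by
      have : x ^ 2 * (n ^ 2 * W) = s ^ 2 * a ^ 2 / W := by rw [hx, ha]; field_simp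
      rw [this, div_le_iff₀ hW0]
      nlinarith [mul_nonneg (sq_nonneg s) (sq_nonneg a)]
    have h4 : min 1 |x| ≤ 2 * (1 + |s|) * B := by
      have hx1 : |x| ≤ 2 * |s| * |D| := by
        rw [hx, abs_mul, abs_div, abs_of_pos hW0]
        rw [show 2 * |s| * |D| = |s| * (2 * |D|) by ring]
        gcongr
        rw [div_le_iff₀ hW0]
        nlinarith [abs_nonneg D]
      refine le_trans ?_ (mul_le_mul_of_nonneg_left hB2 (by positivity))
      rcases le_total 1 |D| with h | h
      · rw [min_eq_left h]; exact (min_le_left _ _).trans (by linarith)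
      · rw [min_eq_right h]; exact (min_le_right _ _).trans (by nlinarith [abs_nonneg D])
    calc _ ≤ (n ^ 2 * W) * (3 * x ^ 2 * min 1 |x|) + s ^ 2 * a ^ 2 / 2 * |1 - 1 / W| := by
            refine (norm_add_le _ _).trans ?_
            rw [norm_mul, Complex.norm_real, Complex.norm_real, Real.norm_of_nonneg (by positivity),
              norm_mul, Real.norm_of_nonneg (by positivity : 0 ≤ s ^ 2 * a ^ 2 / 2)]
            gcongr
            rfl
      _ = 3 * (x ^ 2 * (n ^ 2 * W)) * min 1 |x| + s ^ 2 * a ^ 2 / 2 * |1 - 1 / W| := by ring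
      _ ≤ 3 * (2 * (s ^ 2 * a ^ 2)) * (2 * (1 + |s|) * B) + s ^ 2 * a ^ 2 / 2 * (2 * B) := by
            gcongr
      _ = (12 * s ^ 2 * (1 + |s|) + s ^ 2) * (a ^ 2 * B) := by ring
      _ ≤ tiltConst s * ((a ^ 2 + b ^ 2) * B) := by
            have h5 : 12 * s ^ 2 * (1 + |s|) + s ^ 2 ≤ tiltConst s := by
              unfold tiltConst; nlinarith [mul_nonneg (sq_nonneg s) hs]
            have h6 := tiltConst_nonneg s
            gcongr
            exact le_add_of_nonneg_right (sq_nonneg b)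

/-! ### Normalized sums of i.i.d. variables on a finite product space -/

/-- The normalized sum `N^{-1/2} ∑ᵢ f (uᵢ)`. -/
noncomputable def normSum {E : Type*} {N : ℕ} (f : E → ℝ) (u : Fin N → E) : ℝ :=
  (1 / √(N : ℝ)) * ∑ i, f (u i)

/-- The average `N⁻¹ ∑ᵢ f (uᵢ)`. -/
noncomputable def blockAvg {E : Type*} {N : ℕ} (f : E → ℝ) (u : Fin N → E) : ℝ :=
  (1 / (N : ℝ)) * ∑ i, f (u i)

lemma sqrt_mul_blockAvg {E : Type*} {N : ℕ} (f : E → ℝ) (u : Fin N → E) :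
    √(N : ℝ) * blockAvg f u = normSum f u := by
  unfold blockAvg normSum
  rcases Nat.eq_zero_or_pos N with rfl | h
  · simp
  · have : (0 : ℝ) < N := by exact_mod_cast h
    have h2 := Real.sq_sqrt this.le
    have h3 : 0 < √(N : ℝ) := Real.sqrt_pos.2 this
    field_simp
    rw [h2]

lemma blockAvg_sub_one {E : Type*} {N : ℕ} (hN : 0 < N) (f : E → ℝ) (u : Fin N → E) :
    blockAvg (fun x => f x - 1) u = blockAvg f u - 1 := by
  unfold blockAvg
  have : (0 : ℝ) < N := by exact_mod_cast hN
  simp only [Finset.sum_sub_distrib, Finset.sum_const, Finset.card_univ, Fintype.card_fin,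
    nsmul_eq_mul, mul_one]
  field_simp

lemma blockAvg_nonneg {E : Type*} {N : ℕ} {f : E → ℝ} (hf : ∀ x, 0 ≤ f x) (u : Fin N → E) :
    0 ≤ blockAvg f u :=
  mul_nonneg (by positivity) (Finset.sum_nonneg fun i _ => hf _)

section
variable {E : Type*} [MeasurableSpace E] {N : ℕ} {f : E → ℝ}

@[fun_prop]
lemma measurable_normSum (hf : Measurable f) : Measurable (normSum (N := N) f) := by
  unfold normSum; fun_prop

@[fun_prop]
lemma measurable_blockAvg (hf : Measurable f) : Measurable (blockAvg (N := N) f) := by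
  unfold blockAvg; fun_prop

variable {γ : Measure E} [IsProbabilityMeasure γ]

lemma memLp_eval_pi {p : ENNReal} (hf : MemLp f p γ) (i : Fin N) :
    MemLp (fun u : Fin N → E => f (u i)) p (Measure.pi fun _ => γ) :=
  hf.comp_measurePreserving (measurePreserving_eval (fun _ : Fin N => γ) i)

lemma integral_eval_pi (hf : AEStronglyMeasurable f γ) (i : Fin N) :
    ∫ u : Fin N → E, f (u i) ∂(Measure.pi fun _ => γ) = ∫ x, f x ∂γ :=
  integral_comp_eval (μ := fun _ : Fin N => γ) hf

lemma memLp_sum_pi {p : ENNReal} (hf : MemLp f p γ) :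
    MemLp (fun u : Fin N → E => ∑ i, f (u i)) p (Measure.pi fun _ => γ) := by
  exact memLp_finsetSum _ fun i _ => memLp_eval_pi hf i

lemma memLp_normSum {p : ENNReal} (hf : MemLp f p γ) :
    MemLp (normSum (N := N) f) p (Measure.pi fun _ => γ) :=
  (memLp_sum_pi hf).const_mul _

lemma memLp_blockAvg {p : ENNReal} (hf : MemLp f p γ) :
    MemLp (blockAvg (N := N) f) p (Measure.pi fun _ => γ) :=
  (memLp_sum_pi hf).const_mul _

lemma integral_sum_pi (hf : Integrable f γ) :
    ∫ u : Fin N → E, ∑ i, f (u i) ∂(Measure.pi fun _ => γ) = N * ∫ x, f x ∂γ := by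
  rw [integral_finsetSum]
  · simp [integral_eval_pi hf.aestronglyMeasurable]
  · intro i _
    exact memLp_one_iff_integrable.1 (memLp_eval_pi (memLp_one_iff_integrable.2 hf) i)

lemma integral_blockAvg (hN : 0 < N) (hf : Integrable f γ) :
    ∫ u : Fin N → E, blockAvg f u ∂(Measure.pi fun _ => γ) = ∫ x, f x ∂γ := by
  unfold blockAvg
  have : (0 : ℝ) < N := by exact_mod_cast hN
  rw [integral_const_mul, integral_sum_pi hf]
  field_simp

lemma integral_normSum_sq (hN : 0 < N) (hf : MemLp f 2 γ) (h0 : ∫ x, f x ∂γ = 0) :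
    ∫ u : Fin N → E, normSum f u ^ 2 ∂(Measure.pi fun _ => γ) = ∫ x, f x ^ 2 ∂γ := by
  have hN' : (0 : ℝ) < N := by exact_mod_cast hN
  have h := variance_sum_pi (μ := fun _ : Fin N => γ) (X := fun _ => f) fun _ => hf
  have hm := integral_sum_pi (N := N) (hf.integrable one_le_two)
  rw [h0, mul_zero] at hm
  rw [variance_of_integral_eq_zero (memLp_sum_pi hf |>.aestronglyMeasurable.aemeasurable.congr
      (by filter_upwards with u; simp))
    (by simpa using hm)] at h
  simp only [Finset.sum_apply, variance_of_integral_eq_zero hf.aestronglyMeasurable.aemeasurable h0,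
    Finset.sum_const, Finset.card_univ, Fintype.card_fin, nsmul_eq_mul] at h
  unfold normSum
  simp only [mul_pow, integral_const_mul, h]
  rw [div_pow, Real.sq_sqrt hN'.le]
  field_simp

lemma integrable_of_bounded {α : Type*} [MeasurableSpace α] {μ : Measure α} [IsFiniteMeasure μ]
    {g : α → ℝ} (hg : Measurable g) (C : ℝ) (h : ∀ x, |g x| ≤ C) : Integrable g μ :=
  Integrable.of_bound hg.aestronglyMeasurable C (ae_of_all _ h)

/-- Both moments run through one induction: when a variable is added, the odd cross terms vanish by
independence and centring, and `6 E[S²] E[X²]` needs the second-moment bound. The constant closes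
because `3 m² + 6 m + 1 ≤ 3 (m + 1)²`. -/
lemma integral_sum_pow_four_le {c : ℝ} (hf : Measurable f) (hc : ∀ x, |f x| ≤ c)
    (h0 : ∫ x, f x ∂γ = 0) (s : Finset (Fin N)) :
    ∫ u : Fin N → E, (∑ i ∈ s, f (u i)) ^ 4 ∂(Measure.pi fun _ => γ) ≤ 3 * (s.card : ℝ) ^ 2 * c ^ 4
    ∧ ∫ u : Fin N → E, (∑ i ∈ s, f (u i)) ^ 2 ∂(Measure.pi fun _ => γ) ≤ (s.card : ℝ) * c ^ 2 := by
  set π := (Measure.pi fun _ : Fin N => γ) with hπ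
  have hind : iIndepFun (fun i (u : Fin N → E) => f (u i)) π :=
    iIndepFun_pi (fun _ => hf.aemeasurable)
  have hm : ∀ i, Measurable fun u : Fin N → E => f (u i) := fun i => by fun_prop
  induction s using Finset.cons_induction with
  | empty => simp
  | cons j s hj ih =>
    have hi := (hind.indepFun_finsetSum_of_notMem hm hj)
    set S : (Fin N → E) → ℝ := fun u => ∑ i ∈ s, f (u i) with hS
    have hSe : (∑ i ∈ s, fun u : Fin N → E => f (u i)) = S := by ext; simp [hS]
    rw [hSe] at hi
    have hSm : Measurable S := by fun_prop
    have hSb : ∀ u, |S u| ≤ s.card * c := fun u => by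
      refine (Finset.abs_sum_le_sum_abs _ _).trans ?_
      refine (Finset.sum_le_sum fun i _ => hc (u i)).trans (by simp)
    set X : (Fin N → E) → ℝ := fun u => f (u j) with hX
    have hXm : Measurable X := hm j
    have hXb : ∀ u, |X u| ≤ c := fun u => hc _
    have hc0 : ∀ u : Fin N → E, 0 ≤ c := fun u => (abs_nonneg _).trans (hXb u)
    have hint : ∀ a b : ℕ, Integrable (fun u => S u ^ a * X u ^ b) π := fun a b => by
      refine integrable_of_bounded (by fun_prop) ((s.card * c) ^ a * c ^ b) fun u => ?_
      rw [abs_mul, abs_pow, abs_pow]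
      have := hc0 u
      gcongr
      exacts [hSb u, hXb u]
    have hmul : ∀ a b : ℕ, ∫ u, S u ^ a * X u ^ b ∂π = (∫ u, S u ^ a ∂π) * ∫ u, X u ^ b ∂π :=
      fun a b => (hi.comp (measurable_id.pow_const a) (measurable_id.pow_const b)
        ).integral_fun_mul_eq_mul_integral (by fun_prop) (by fun_prop)
    have hX1 : ∫ u, X u ∂π = 0 := by
      rw [← h0]; exact integral_eval_pi hf.aestronglyMeasurable j
    have hS1 : ∫ u, S u ∂π = 0 := by
      rw [hS, integral_finsetSum]
      · exact Finset.sum_eq_zero fun i _ => (integral_eval_pi hf.aestronglyMeasurable i).trans h0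
      · intro i _; exact integrable_of_bounded (hm i) c fun u => hc _
    have hXp : ∀ b : ℕ, ∫ u, X u ^ b ∂π ≤ c ^ b := fun b => by
      have : ∫ u, X u ^ b ∂π ≤ ∫ u, c ^ b ∂π := by
        refine integral_mono (by simpa using hint 0 b) (integrable_const _) fun u => ?_
        refine (le_abs_self _).trans ?_
        rw [abs_pow]
        gcongr
        exact hXb u
      simpa using this
    have hS2 : 0 ≤ ∫ u, S u ^ 2 ∂π := integral_nonneg fun u => sq_nonneg _
    have hX2 : 0 ≤ ∫ u, X u ^ 2 ∂π := integral_nonneg fun u => sq_nonneg _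
    have e1 : (fun u : Fin N → E => (∑ i ∈ Finset.cons j s hj, f (u i)) ^ 2) =
        fun u => S u ^ 2 * X u ^ 0 + 2 * (S u ^ 1 * X u ^ 1) + S u ^ 0 * X u ^ 2 := by
      ext u; rw [Finset.sum_cons]; simp only [hS, hX]; ring
    have e2 : (fun u : Fin N → E => (∑ i ∈ Finset.cons j s hj, f (u i)) ^ 4) =
        fun u => S u ^ 4 * X u ^ 0 + 4 * (S u ^ 3 * X u ^ 1) + 6 * (S u ^ 2 * X u ^ 2)
          + 4 * (S u ^ 1 * X u ^ 3) + S u ^ 0 * X u ^ 4 := by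
      ext u; rw [Finset.sum_cons]; simp only [hS, hX]; ring
    have hc2 : 0 ≤ c ^ 2 := sq_nonneg c
    rw [e1, e2, Finset.card_cons]
    constructor
    · rw [integral_add (by fun_prop) (hint _ _), integral_add (by fun_prop) (by fun_prop),
        integral_add (by fun_prop) (by fun_prop),
        integral_add (hint _ _) (by fun_prop), integral_const_mul, integral_const_mul,
        integral_const_mul, hmul, hmul, hmul, hmul, hmul]
      simp only [pow_one, hX1, hS1, pow_zero, integral_const, probReal_univ, smul_eq_mul]
      have h1 : (∫ u, S u ^ 2 ∂π) * ∫ u, X u ^ 2 ∂π ≤ (s.card * c ^ 2) * c ^ 2 :=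
        mul_le_mul ih.2 (hXp 2) hX2 (by positivity)
      have h4 := hXp 4
      push_cast
      nlinarith [ih.1, pow_nonneg hc2 2]
    · rw [integral_add (by fun_prop) (hint _ _), integral_add (hint _ _) (by fun_prop),
        integral_const_mul, hmul, hmul, hmul]
      simp only [pow_one, hX1, hS1, pow_zero, integral_const, probReal_univ, smul_eq_mul]
      have h4 := hXp 2
      push_cast
      nlinarith [ih.2]

lemma integral_normSum_pow_four_le {c : ℝ} (hN : 0 < N) (hf : Measurable f) (hc : ∀ x, |f x| ≤ c)
    (h0 : ∫ x, f x ∂γ = 0) :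
    ∫ u : Fin N → E, normSum f u ^ 4 ∂(Measure.pi fun _ => γ) ≤ 3 * c ^ 4 := by
  have hN' : (0 : ℝ) < N := by exact_mod_cast hN
  have h := (integral_sum_pow_four_le hf hc h0 (Finset.univ : Finset (Fin N))).1
  unfold normSum
  simp only [mul_pow, integral_const_mul]
  rw [div_pow, show √(N : ℝ) ^ 4 = (N : ℝ) ^ 2 by
    rw [show 4 = 2 * 2 by rfl, pow_mul, Real.sq_sqrt hN'.le], one_pow]
  simp only [Finset.card_univ, Fintype.card_fin] at h
  rw [one_div_mul_eq_div, div_le_iff₀ (by positivity)]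
  linarith

/-- A centred square integrable function is the sum of a bounded centred one and a remainder that
is small in `L²`. -/
lemma exists_bounded_centred_approx (hf : Measurable f) (hf2 : MemLp f 2 γ) (h0 : ∫ x, f x ∂γ = 0)
    {δ : ℝ} (hδ : 0 < δ) :
    ∃ a : E → ℝ, ∃ c : ℝ, Measurable a ∧ (∀ x, |a x| ≤ c) ∧ ∫ x, a x ∂γ = 0 ∧
      ∫ x, (f x - a x) ^ 2 ∂γ < δ := by
  have hlim : Tendsto (fun n : ℕ => ∫ x, {x | (n : ℝ) < |f x|}.indicator (fun x => f x ^ 2) x ∂γ)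
      atTop (𝓝 (∫ x, (0 : ℝ) ∂γ)) := by
    refine tendsto_integral_of_dominated_convergence (fun x => f x ^ 2) (fun n => ?_)
      hf2.integrable_sq (fun n => ae_of_all _ fun x => ?_) (ae_of_all _ fun x => ?_)
    · exact ((by fun_prop : Measurable fun x => f x ^ 2).indicator
        (measurableSet_lt measurable_const (by fun_prop))).aestronglyMeasurable
    · rw [Real.norm_of_nonneg (Set.indicator_nonneg (fun _ _ => sq_nonneg _) _)]
      exact Set.indicator_le_self' (fun _ _ => sq_nonneg _) x
    · obtain ⟨n, hn⟩ := exists_nat_ge |f x|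
      refine tendsto_const_nhds.congr' ?_
      filter_upwards [eventually_ge_atTop n] with m hm
      have : (n : ℝ) ≤ m := by exact_mod_cast hm
      simp [Set.indicator, not_lt.2 (hn.trans this)]
  simp only [integral_zero] at hlim
  obtain ⟨n, hn⟩ := (hlim.eventually (gt_mem_nhds hδ)).exists
  set b : E → ℝ := {x | (n : ℝ) < |f x|}.indicator f with hb
  have hbm : Measurable b := hf.indicator (measurableSet_lt measurable_const (by fun_prop))
  have hb2 : MemLp b 2 γ := hf2.indicator (measurableSet_lt measurable_const (by fun_prop))
  have hbi := hb2.integrable one_le_two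
  have hfi := hf2.integrable one_le_two
  -- Removing the large values `b` spoils the centring, which adding `∫ b` restores. The remainder
  -- is `b - ∫ b`, whose second moment is a variance and so at most `∫ b²`.
  refine ⟨fun x => f x - b x + ∫ y, b y ∂γ, n + |∫ y, b y ∂γ|, by fun_prop, fun x => ?_, ?_, ?_⟩
  · refine (abs_add_le _ _).trans ?_
    gcongr
    by_cases hx : (n : ℝ) < |f x|
    · simp [hb, hx]
    · have : b x = 0 := by simp [hb, hx]
      rw [this, sub_zero]
      exact not_lt.1 hx
  · change ∫ x, (f x - b x + ∫ y, b y ∂γ) ∂γ = 0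
    rw [integral_add (by fun_prop) (integrable_const _), integral_sub hfi hbi, h0]
    simp
  · have e : ∀ x, (f x - (f x - b x + ∫ y, b y ∂γ)) ^ 2 = (b x - ∫ y, b y ∂γ) ^ 2 := fun x => by
      ring
    simp only [e]
    have hv : ∫ x, (b x - ∫ y, b y ∂γ) ^ 2 ∂γ = Var[b; γ] :=
      (variance_eq_integral hbm.aemeasurable).symm
    rw [hv]
    refine (variance_le_expectation_sq hbm.aestronglyMeasurable).trans_lt ?_
    refine lt_of_eq_of_lt ?_ hn
    congr 1
    ext x
    simp only [hb, Set.indicator, Pi.pow_apply]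
    split_ifs <;> simp

/-- Uniform integrability of the squared normalized sums, tested against small weights. -/
lemma exists_integral_normSum_sq_mul_le (hf : Measurable f) (hf2 : MemLp f 2 γ)
    (h0 : ∫ x, f x ∂γ = 0) {δ : ℝ} (hδ : 0 < δ) :
    ∃ C : ℝ, 0 ≤ C ∧ ∀ N : ℕ, 0 < N → ∀ B : (Fin N → E) → ℝ, Measurable B →
      (∀ u, 0 ≤ B u) → (∀ u, B u ≤ 2) →
      ∫ u, normSum f u ^ 2 * B u ∂(Measure.pi fun _ => γ) ≤
        δ + C * ∫ u, B u ∂(Measure.pi fun _ => γ) := by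
  obtain ⟨a, c, ham, hac, ha0, had⟩ := exists_bounded_centred_approx hf hf2 h0
    (by positivity : 0 < δ / 8)
  have hc4 : 0 ≤ c ^ 4 := by positivity
  -- Chosen so that the bounded part costs `2 η * 3 c⁴ ≤ δ / 2`; the remainder costs `4 * (δ / 8) =
  -- δ / 2`. The `+ 1` guards against `c = 0`.
  set η : ℝ := δ / (12 * (c ^ 4 + 1)) with hη
  have hη0 : 0 < η := by positivity
  refine ⟨1 / η, by positivity, fun N hN B hBm hB0 hB2 => ?_⟩
  set π := (Measure.pi fun _ : Fin N => γ)
  have ha2 : MemLp a 2 γ := MemLp.of_bound ham.aestronglyMeasurable c (ae_of_all _ hac)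
  have hb2 : MemLp (fun x => f x - a x) 2 γ := hf2.sub ha2
  have hb0 : ∫ x, (f x - a x) ∂γ = 0 := by
    rw [integral_sub (hf2.integrable one_le_two) (ha2.integrable one_le_two), h0, ha0, sub_zero]
  have hB := integral_normSum_sq hN hb2 hb0
  have hA := integral_normSum_pow_four_le hN ham hac ha0
  have hsplit : ∀ u : Fin N → E, normSum f u = normSum a u + normSum (fun x => f x - a x) u := by
    intro u
    simp only [normSum, ← mul_add, ← Finset.sum_add_distrib, add_sub_cancel]
  have hiB : Integrable B π := integrable_of_bounded hBm 2 fun u => by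
    rw [abs_of_nonneg (hB0 u)]; exact hB2 u
  have hiA : Integrable (fun u : Fin N → E => normSum a u ^ 4) π := by
    have h4 : MemLp (normSum (N := N) a) 4 π :=
      memLp_normSum (MemLp.of_bound ham.aestronglyMeasurable c (ae_of_all _ hac))
    have := h4.integrable_norm_pow (by norm_num)
    refine this.congr (ae_of_all _ fun u => ?_)
    simp only [Real.norm_eq_abs, ← abs_pow]
    exact abs_of_nonneg (by positivity)
  have hib : Integrable (fun u : Fin N → E => normSum (fun x => f x - a x) u ^ 2) π :=
    (memLp_normSum hb2).integrable_sq
  -- Young's inequality separates the bounded part from `B`, using `B² ≤ 2 B`; the remainder only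
  -- uses `B ≤ 2`.
  have hpt : ∀ u, normSum f u ^ 2 * B u ≤ 2 * η * normSum a u ^ 4 + 1 / η * B u +
      4 * normSum (fun x => f x - a x) u ^ 2 := by
    intro u
    rw [hsplit u]
    set x := normSum a u
    set y := normSum (fun x => f x - a x) u
    have h1 : (x + y) ^ 2 * B u ≤ (2 * x ^ 2 + 2 * y ^ 2) * B u :=
      mul_le_mul_of_nonneg_right (by nlinarith [sq_nonneg (x - y)]) (hB0 u)
    have h2 : 2 * y ^ 2 * B u ≤ 4 * y ^ 2 := by nlinarith [sq_nonneg y, hB2 u]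
    have h3 : 2 * x ^ 2 * B u ≤ 2 * η * x ^ 4 + 1 / η * B u := by
      have : B u ^ 2 ≤ 2 * B u := by nlinarith [hB0 u, hB2 u]
      have h5 : 2 * x ^ 2 * B u ≤ 2 * η * x ^ 4 + B u ^ 2 / (2 * η) := by
        rw [← sub_nonneg]
        have : 2 * η * x ^ 4 + B u ^ 2 / (2 * η) - 2 * x ^ 2 * B u =
          (2 * η * x ^ 2 - B u) ^ 2 / (2 * η) := by field_simp; ring
        rw [this]; positivity
      have h6 : B u ^ 2 / (2 * η) ≤ 1 / η * B u := by
        rw [div_le_iff₀ (by positivity)]; field_simp; linarith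
      linarith
    nlinarith
  calc ∫ u, normSum f u ^ 2 * B u ∂π
      ≤ ∫ u, (2 * η * normSum a u ^ 4 + 1 / η * B u + 4 * normSum (fun x => f x - a x) u ^ 2) ∂π := by
        refine integral_mono_of_nonneg (ae_of_all _ fun u => mul_nonneg (sq_nonneg _) (hB0 u))
          (by fun_prop) (ae_of_all _ hpt)
    _ = 2 * η * ∫ u, normSum a u ^ 4 ∂π + 1 / η * ∫ u, B u ∂π + 4 * ∫ x, (f x - a x) ^ 2 ∂γ := by
        rw [integral_add (by fun_prop) (by fun_prop), integral_add (by fun_prop) (by fun_prop),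
          integral_const_mul, integral_const_mul, integral_const_mul, hB]
    _ ≤ 2 * η * (3 * c ^ 4) + 1 / η * ∫ u, B u ∂π + 4 * (δ / 8) := by gcongr
    _ ≤ _ := by
        have : 2 * η * (3 * c ^ 4) ≤ δ / 2 := by
          rw [hη]
          have : δ / (12 * (c ^ 4 + 1)) * c ^ 4 ≤ δ / 12 := by
            rw [div_mul_eq_mul_div, div_le_div_iff₀ (by positivity) (by norm_num)]
            nlinarith
          linarith
        linarith
end

/-! ### ### Second-order expansion for one tilted block -/

/-- A normalized importance weight `w` with its parameter derivative `d`, both square integrable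
under the proposal law `γ`. -/
structure IsWeightPair {E : Type*} [MeasurableSpace E] (γ : Measure E) (w d : E → ℝ) : Prop where
  measurable_w : Measurable w
  measurable_d : Measurable d
  nonneg : ∀ x, 0 ≤ w x
  memLp_w : MemLp w 2 γ
  memLp_d : MemLp d 2 γ
  integral_w : ∫ x, w x ∂γ = 1
  integral_d : ∫ x, d x ∂γ = 0

/-- The second moment `E[d²] + E[(w - 1)²]` that controls the expansion. -/
noncomputable def pairMoment {E : Type*} [MeasurableSpace E] (γ : Measure E) (w d : E → ℝ) : ℝ :=
  ∫ x, d x ^ 2 ∂γ + ∫ x, (w x - 1) ^ 2 ∂γ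

/-- The remainder of the second-order expansion of the tilted characteristic function. -/
noncomputable def tiltErr {E : Type*} [MeasurableSpace E] (γ : Measure E) (w d : E → ℝ) (N : ℕ) :
    ℝ :=
  ∫ u : Fin N → E, (normSum d u ^ 2 + normSum (fun x => w x - 1) u ^ 2) *
    (min 1 |blockAvg w u - 1| + min 1 |blockAvg d u|) ∂(Measure.pi fun _ => γ)

/-- The characteristic function of `blockAvg d / blockAvg w` under the law with density
`blockAvg w`. -/
noncomputable def tiltChar {E : Type*} [MeasurableSpace E] (γ : Measure E) (w d : E → ℝ) (N : ℕ)
    (s : ℝ) : ℂ :=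
  ∫ u : Fin N → E, (blockAvg w u : ℂ) *
    Complex.exp (Complex.I * ((s * (blockAvg d u / blockAvg w u) : ℝ) : ℂ))
    ∂(Measure.pi fun _ => γ)

section
variable {E : Type*} [MeasurableSpace E] {γ : Measure E}

lemma pairMoment_nonneg (w d : E → ℝ) : 0 ≤ pairMoment γ w d :=
  add_nonneg (integral_nonneg fun _ => sq_nonneg _) (integral_nonneg fun _ => sq_nonneg _)

lemma tiltErr_nonneg (w d : E → ℝ) (N : ℕ) : 0 ≤ tiltErr γ w d N :=
  integral_nonneg fun u => by positivity

namespace IsWeightPair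
variable {w d : E → ℝ} {N : ℕ}

lemma measurable_sub (h : IsWeightPair γ w d) : Measurable fun x => w x - 1 :=
  h.measurable_w.sub_const 1

lemma measurable_cutoff (h : IsWeightPair γ w d) : Measurable fun u : Fin N → E =>
    min 1 |blockAvg w u - 1| + min 1 |blockAvg d u| := by
  have := h.measurable_w; have := h.measurable_d
  fun_prop

variable [IsProbabilityMeasure γ]

lemma memLp_sub (h : IsWeightPair γ w d) : MemLp (fun x => w x - 1) 2 γ :=
  h.memLp_w.sub (memLp_const 1)

lemma integral_sub (h : IsWeightPair γ w d) : ∫ x, (w x - 1) ∂γ = 0 := by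
  rw [MeasureTheory.integral_sub (h.memLp_w.integrable one_le_two) (integrable_const _),
    h.integral_w]
  simp

lemma integrable_moment (h : IsWeightPair γ w d) : Integrable
    (fun u : Fin N → E => normSum d u ^ 2 + normSum (fun x => w x - 1) u ^ 2)
    (Measure.pi fun _ => γ) :=
  (memLp_normSum h.memLp_d).integrable_sq.add (memLp_normSum h.memLp_sub).integrable_sq

lemma integral_moment (h : IsWeightPair γ w d) (hN : 0 < N) :
    ∫ u : Fin N → E, (normSum d u ^ 2 + normSum (fun x => w x - 1) u ^ 2)
    ∂(Measure.pi fun _ => γ) = pairMoment γ w d := by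
  rw [integral_add (memLp_normSum h.memLp_d).integrable_sq
    (memLp_normSum h.memLp_sub).integrable_sq, integral_normSum_sq hN h.memLp_d h.integral_d,
    integral_normSum_sq hN h.memLp_sub h.integral_sub, pairMoment]

lemma integrable_tiltErr (h : IsWeightPair γ w d) : Integrable (fun u : Fin N → E =>
    (normSum d u ^ 2 + normSum (fun x => w x - 1) u ^ 2) *
    (min 1 |blockAvg w u - 1| + min 1 |blockAvg d u|)) (Measure.pi fun _ => γ) := by
  refine h.integrable_moment.mul_bdd (c := 2) h.measurable_cutoff.aestronglyMeasurable
    (ae_of_all _ fun u => ?_)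
  rw [Real.norm_of_nonneg (by positivity)]
  linarith [min_le_left 1 |blockAvg w u - 1|, min_le_left 1 |blockAvg d u|]

/-- The cutoff never exceeds `2`. The bound is uniform in `N` and serves as the dominating function
when averaging over the data. -/
lemma tiltErr_le (h : IsWeightPair γ w d) (hN : 0 < N) :
    tiltErr γ w d N ≤ 2 * pairMoment γ w d := by
  rw [← h.integral_moment hN, ← integral_const_mul]
  refine integral_mono h.integrable_tiltErr (h.integrable_moment.const_mul _) fun u => ?_
  have := add_le_add (min_le_left 1 |blockAvg w u - 1|) (min_le_left 1 |blockAvg d u|)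
  have h2 : 0 ≤ normSum d u ^ 2 + normSum (fun x => w x - 1) u ^ 2 := by positivity
  dsimp only
  nlinarith

/-- From `|z| ≤ 1 + z²` with `z = √N * blockAvg f`, whose second moment does not depend on `N`. -/
lemma integral_abs_blockAvg_le {f : E → ℝ} (hN : 0 < N) (hf : MemLp f 2 γ)
    (h0 : ∫ x, f x ∂γ = 0) :
    ∫ u : Fin N → E, |blockAvg f u| ∂(Measure.pi fun _ => γ) ≤ (1 + ∫ x, f x ^ 2 ∂γ) / √(N : ℝ) := by
  have hs : 0 < √(N : ℝ) := Real.sqrt_pos.2 (by exact_mod_cast hN)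
  rw [← integral_normSum_sq hN hf h0, le_div_iff₀ hs, ← integral_mul_const]
  have hi := (memLp_normSum (N := N) hf).integrable_sq
  have : 1 + ∫ u : Fin N → E, normSum f u ^ 2 ∂(Measure.pi fun _ => γ) =
      ∫ u : Fin N → E, (1 + normSum f u ^ 2) ∂(Measure.pi fun _ => γ) := by
    rw [integral_add (integrable_const _) hi]; simp
  rw [this]
  refine integral_mono (((memLp_blockAvg hf).integrable one_le_two).abs.mul_const _)
    ((integrable_const _).add hi) fun u => ?_
  dsimp only
  have h2 : |blockAvg f u| * √(N : ℝ) = |normSum f u| := by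
    rw [← sqrt_mul_blockAvg, abs_mul, abs_of_pos hs, mul_comm]
  rw [h2]
  nlinarith [sq_nonneg (|normSum f u| - 1), sq_abs (normSum f u)]

lemma integral_cutoff_le (h : IsWeightPair γ w d) (hN : 0 < N) :
    ∫ u : Fin N → E, (min 1 |blockAvg w u - 1| + min 1 |blockAvg d u|) ∂(Measure.pi fun _ => γ) ≤
      (2 + pairMoment γ w d) / √(N : ℝ) := by
  have h1 := integral_abs_blockAvg_le hN h.memLp_d h.integral_d
  have h2 := integral_abs_blockAvg_le hN h.memLp_sub h.integral_sub
  have i1 := ((memLp_blockAvg (N := N) h.memLp_d).integrable one_le_two).abs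
  have i2 := ((memLp_blockAvg (N := N) h.memLp_sub).integrable one_le_two).abs
  calc _ ≤ ∫ u : Fin N → E, (|blockAvg (fun x => w x - 1) u| + |blockAvg d u|)
        ∂(Measure.pi fun _ => γ) := by
        refine integral_mono_of_nonneg (ae_of_all _ fun u => by positivity) (i2.add i1)
          (ae_of_all _ fun u => ?_)
        dsimp only
        rw [blockAvg_sub_one hN]
        gcongr <;> exact min_le_right _ _
    _ ≤ _ := by
        rw [integral_add i2 i1, pairMoment]
        refine (add_le_add h2 h1).trans (le_of_eq ?_)
        ring

/-- The squared normalized sums do not shrink, but they are uniformly integrable, while the cutoff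
has integral `O(N^{-1/2})`. -/
lemma tendsto_tiltErr (h : IsWeightPair γ w d) :
    Tendsto (fun N => tiltErr γ w d N) atTop (𝓝 0) := by
  rw [Metric.tendsto_atTop]
  intro δ hδ
  obtain ⟨C₁, hC₁, H₁⟩ := exists_integral_normSum_sq_mul_le h.measurable_d h.memLp_d h.integral_d
    (by positivity : 0 < δ / 4)
  obtain ⟨C₂, hC₂, H₂⟩ := exists_integral_normSum_sq_mul_le h.measurable_sub h.memLp_sub
    h.integral_sub (by positivity : 0 < δ / 4)
  have hlim : Tendsto (fun N : ℕ => (C₁ + C₂) * ((2 + pairMoment γ w d) / √(N : ℝ))) atTop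
      (𝓝 ((C₁ + C₂) * 0)) := by
    refine Tendsto.const_mul _ (Tendsto.div_atTop tendsto_const_nhds ?_)
    exact Real.tendsto_sqrt_atTop.comp tendsto_natCast_atTop_atTop
  rw [mul_zero] at hlim
  obtain ⟨N₀, hN₀⟩ := eventually_atTop.1 ((hlim.eventually (gt_mem_nhds (by positivity :
    0 < δ / 2))).and (eventually_gt_atTop 0))
  refine ⟨N₀, fun N hN => ?_⟩
  obtain ⟨hlt, hpos⟩ := hN₀ N hN
  rw [Real.dist_eq, sub_zero, abs_of_nonneg (tiltErr_nonneg _ _ _)]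
  have hB0 : ∀ u : Fin N → E, 0 ≤ min 1 |blockAvg w u - 1| + min 1 |blockAvg d u| :=
    fun u => by positivity
  have hB2 : ∀ u : Fin N → E, min 1 |blockAvg w u - 1| + min 1 |blockAvg d u| ≤ 2 := fun u => by
    linarith [min_le_left 1 |blockAvg w u - 1|, min_le_left 1 |blockAvg d u|]
  have e₁ := H₁ N hpos _ h.measurable_cutoff hB0 hB2
  have e₂ := H₂ N hpos _ h.measurable_cutoff hB0 hB2
  have hB := h.integral_cutoff_le hpos
  have hi : ∀ f : E → ℝ, MemLp f 2 γ → Integrable (fun u : Fin N → E => normSum f u ^ 2 *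
      (min 1 |blockAvg w u - 1| + min 1 |blockAvg d u|)) (Measure.pi fun _ => γ) := fun f hf => by
    refine (memLp_normSum hf).integrable_sq.mul_bdd (c := 2) h.measurable_cutoff.aestronglyMeasurable
      (ae_of_all _ fun u => ?_)
    rw [Real.norm_of_nonneg (hB0 u)]
    exact hB2 u
  unfold tiltErr
  simp only [add_mul _ _ (min _ _ + _)]
  rw [integral_add (hi _ h.memLp_d) (hi _ h.memLp_sub)]
  set b := ∫ u : Fin N → E, (min 1 |blockAvg w u - 1| + min 1 |blockAvg d u|)
    ∂(Measure.pi fun _ => γ)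
  have : (C₁ + C₂) * b ≤ (C₁ + C₂) * ((2 + pairMoment γ w d) / √(N : ℝ)) := by gcongr
  nlinarith

lemma integrable_w_avg (h : IsWeightPair γ w d) :
    Integrable (blockAvg (N := N) w) (Measure.pi fun _ => γ) :=
  (memLp_blockAvg h.memLp_w).integrable one_le_two

lemma integrable_d_avg (h : IsWeightPair γ w d) :
    Integrable (blockAvg (N := N) d) (Measure.pi fun _ => γ) :=
  (memLp_blockAvg h.memLp_d).integrable one_le_two

lemma integrable_tiltChar (h : IsWeightPair γ w d) (s : ℝ) :
    Integrable (fun u : Fin N → E => (blockAvg w u : ℂ) *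
      Complex.exp (Complex.I * ((s * (blockAvg d u / blockAvg w u) : ℝ) : ℂ)))
      (Measure.pi fun _ => γ) := by
  have := h.measurable_w; have := h.measurable_d
  refine h.integrable_w_avg.ofReal.mul_bdd (c := 1) (Measurable.aestronglyMeasurable (by fun_prop))
    (ae_of_all _ fun u => ?_)
  rw [Complex.norm_exp_I_mul_ofReal]

lemma norm_tiltChar_le (h : IsWeightPair γ w d) (hN : 0 < N) (s : ℝ) :
    ‖tiltChar γ w d N s‖ ≤ 1 := by
  refine (norm_integral_le_integral_norm _).trans (le_of_eq ?_)
  rw [← h.integral_w, ← integral_blockAvg hN (h.memLp_w.integrable one_le_two)]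
  congr 1
  ext u
  rw [norm_mul, Complex.norm_exp_I_mul_ofReal, mul_one, Complex.norm_real,
    Real.norm_of_nonneg (blockAvg_nonneg h.nonneg u)]

/-- The subtracted terms have known integrals: `E[W] = 1`, `E[s D] = 0`, and the squared normalized
sum integrates to `E[d²]`. No term of order `√N` survives, so only the pointwise remainder has to be
integrated. -/
lemma norm_tiltChar_sub_le (h : IsWeightPair γ w d) (hN : 0 < N) (s : ℝ) :
    ‖(N : ℂ) * (tiltChar γ w d N s - 1) + (s : ℂ) ^ 2 * ((∫ x, d x ^ 2 ∂γ : ℝ) : ℂ) / 2‖ ≤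
      tiltConst s * tiltErr γ w d N := by
  set π := Measure.pi fun _ : Fin N => γ
  have i1 := h.integrable_tiltChar (N := N) s
  have i2 : Integrable (fun u : Fin N → E => ((blockAvg w u : ℝ) : ℂ)) π := h.integrable_w_avg.ofReal
  have i3 : Integrable (fun u : Fin N → E => Complex.I * ((s * blockAvg d u : ℝ) : ℂ)) π :=
    ((h.integrable_d_avg.const_mul s).ofReal).const_mul _
  have i4 : Integrable (fun u : Fin N → E => ((normSum d u ^ 2 : ℝ) : ℂ)) π :=
    (memLp_normSum h.memLp_d).integrable_sq.ofReal
  have e2 : ∫ u : Fin N → E, ((blockAvg w u : ℝ) : ℂ) ∂π = 1 := by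
    rw [integral_complex_ofReal, integral_blockAvg hN (h.memLp_w.integrable one_le_two),
      h.integral_w]; simp
  have e3 : ∫ u : Fin N → E, Complex.I * ((s * blockAvg d u : ℝ) : ℂ) ∂π = 0 := by
    rw [integral_const_mul, integral_complex_ofReal, integral_const_mul,
      integral_blockAvg hN (h.memLp_d.integrable one_le_two), h.integral_d]; simp
  have e4 : ∫ u : Fin N → E, ((normSum d u ^ 2 : ℝ) : ℂ) ∂π = ((∫ x, d x ^ 2 ∂γ : ℝ) : ℂ) := by
    rw [integral_complex_ofReal, integral_normSum_sq hN h.memLp_d h.integral_d]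
  have key : (N : ℂ) * (tiltChar γ w d N s - 1) + (s : ℂ) ^ 2 * ((∫ x, d x ^ 2 ∂γ : ℝ) : ℂ) / 2 =
      ∫ u : Fin N → E, ((N : ℂ) * ((blockAvg w u : ℂ) *
        Complex.exp (Complex.I * ((s * (blockAvg d u / blockAvg w u) : ℝ) : ℂ)) - blockAvg w u -
        Complex.I * ((s * blockAvg d u : ℝ) : ℂ)) +
        (s : ℂ) ^ 2 / 2 * ((normSum d u ^ 2 : ℝ) : ℂ)) ∂π := by
    have i12 : Integrable (fun u : Fin N → E => (blockAvg w u : ℂ) *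
        Complex.exp (Complex.I * ((s * (blockAvg d u / blockAvg w u) : ℝ) : ℂ)) - blockAvg w u) π :=
      i1.sub i2
    have i123 : Integrable (fun u : Fin N → E => (blockAvg w u : ℂ) *
        Complex.exp (Complex.I * ((s * (blockAvg d u / blockAvg w u) : ℝ) : ℂ)) - blockAvg w u -
        Complex.I * ((s * blockAvg d u : ℝ) : ℂ)) π := i12.sub i3
    rw [integral_add (i123.const_mul _) (i4.const_mul _), integral_const_mul,
      integral_const_mul, MeasureTheory.integral_sub i12 i3,
      MeasureTheory.integral_sub i1 i2, e2, e3, e4, sub_zero, tiltChar]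
    ring
  rw [key, tiltErr, ← integral_const_mul]
  refine norm_integral_le_of_norm_le (h.integrable_tiltErr.const_mul _) (ae_of_all _ fun u => ?_)
  have hb := norm_tilted_exp_sub_le (n := √(N : ℝ)) (W := blockAvg w u) (D := blockAvg d u) s
    (blockAvg_nonneg h.nonneg u) (Real.sqrt_nonneg _)
  rw [sqrt_mul_blockAvg, ← blockAvg_sub_one hN, sqrt_mul_blockAvg] at hb
  rw [← blockAvg_sub_one hN]
  refine le_trans (le_of_eq ?_) hb
  congr 1
  have : ((√(N : ℝ) : ℂ)) ^ 2 = N := by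
    rw [← Complex.ofReal_pow, Real.sq_sqrt (by positivity)]; simp
  rw [this]
  push_cast
  ring

end IsWeightPair
end

/-! ### Laws of large numbers for triangular arrays -/

section
variable {Ω S : Type*} [MeasurableSpace Ω] [MeasurableSpace S] {P : Measure Ω}
  {μ : Measure S} {Y : ℕ → Ω → S}

lemma tendsto_average_of_iid (hYmeas : ∀ t, Measurable (Y t)) (hYindep : iIndepFun Y P)
    (hYlaw : ∀ t, P.map (Y t) = μ) {f : S → ℝ} (hf : Measurable f) (hfi : Integrable f μ) :
    ∀ᵐ ω ∂P, Tendsto (fun n : ℕ => (∑ k ∈ Finset.range n, f (Y k ω)) / n) atTop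
      (𝓝 (∫ y, f y ∂μ)) := by
  have hint : Integrable (fun ω => f (Y 0 ω)) P := by
    have h : Integrable f (P.map (Y 0)) := by rw [hYlaw]; exact hfi
    exact h.comp_measurable (hYmeas 0)
  have h := strong_law_ae_real (μ := P) (fun k ω => f (Y k ω)) hint
    (fun i j hij => (hYindep.indepFun hij).comp hf hf)
    (fun i => IdentDistrib.comp ⟨(hYmeas i).aemeasurable, (hYmeas 0).aemeasurable,
      by rw [hYlaw, hYlaw]⟩ hf)
  have e : ∫ ω, f (Y 0 ω) ∂P = ∫ y, f y ∂μ := by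
    rw [← hYlaw 0, integral_map (hYmeas 0).aemeasurable hf.aestronglyMeasurable]
  rw [← e]
  exact h

lemma ae_all_of_law (hYmeas : ∀ t, Measurable (Y t)) (hYlaw : ∀ t, P.map (Y t) = μ)
    {p : S → Prop} (hp : ∀ᵐ y ∂μ, p y) : ∀ᵐ ω ∂P, ∀ k, p (Y k ω) :=
  ae_all_iff.2 fun k => ae_of_ae_map (hYmeas k).aemeasurable (by rw [hYlaw]; exact hp)

/-- Averages of a dominated array of functions tending to zero, along i.i.d. data. -/
lemma tendsto_average_of_dominated (hYmeas : ∀ t, Measurable (Y t)) (hYindep : iIndepFun Y P)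
    (hYlaw : ∀ t, P.map (Y t) = μ) {K : ℕ → S → ℝ} {H : S → ℝ} (hK : ∀ n, Measurable (K n))
    (hH : Integrable H μ) (hK0 : ∀ n y, 0 ≤ K n y)
    (hKH : ∀ᵐ y ∂μ, ∀ n, 0 < n → K n y ≤ H y)
    (hlim : ∀ᵐ y ∂μ, Tendsto (fun n => K n y) atTop (𝓝 0)) {m : ℕ → ℕ} (hm : Tendsto m atTop atTop) :
    ∀ᵐ ω ∂P, Tendsto (fun n : ℕ => (∑ k ∈ Finset.range n, K (m n) (Y k ω)) / n) atTop (𝓝 0) := by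
  -- Tail suprema remove the dependence on `n`: the strong law applies to each fixed `G M`, and `∫ G
  -- M → 0` by dominated convergence. The shift by one is there because domination is assumed for
  -- positive indices only.
  set G : ℕ → S → ℝ := fun M y => ⨆ j, K (M + 1 + j) y with hG
  have hGm : ∀ M, Measurable (G M) := fun M => Measurable.iSup fun j => hK _
  have hG0 : ∀ M y, 0 ≤ G M y := fun M y => Real.iSup_nonneg fun j => hK0 _ _
  have hGH : ∀ᵐ y ∂μ, ∀ M, G M y ≤ H y := by
    filter_upwards [hKH] with y hy M
    exact ciSup_le fun j => hy _ (by omega)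
  have hKG : ∀ᵐ y ∂μ, ∀ M n, M + 1 ≤ n → K n y ≤ G M y := by
    filter_upwards [hKH] with y hy M n hn
    have hb : BddAbove (Set.range fun j => K (M + 1 + j) y) :=
      ⟨H y, by rintro _ ⟨j, rfl⟩; exact hy _ (by omega)⟩
    have := le_ciSup hb (n - (M + 1))
    rwa [Nat.add_sub_cancel' hn] at this
  have hGi : ∀ M, Integrable (G M) μ := fun M => by
    refine hH.mono' (hGm M).aestronglyMeasurable ?_
    filter_upwards [hGH] with y hy
    rw [Real.norm_of_nonneg (hG0 M y)]; exact hy M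
  have hGlim : Tendsto (fun M => ∫ y, G M y ∂μ) atTop (𝓝 (∫ _, (0 : ℝ) ∂μ)) := by
    refine tendsto_integral_of_dominated_convergence H (fun M => (hGm M).aestronglyMeasurable) hH
      (fun M => ?_) ?_
    · filter_upwards [hGH] with y hy
      rw [Real.norm_of_nonneg (hG0 M y)]; exact hy M
    · filter_upwards [hlim] with y hy
      rw [Metric.tendsto_atTop] at hy ⊢
      intro ε hε
      obtain ⟨N, hN⟩ := hy (ε / 2) (by positivity)
      refine ⟨N, fun M hM => ?_⟩
      rw [Real.dist_eq, sub_zero, abs_of_nonneg (hG0 M y)]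
      have : G M y ≤ ε / 2 := ciSup_le fun j => by
        have := hN (M + 1 + j) (by omega)
        rw [Real.dist_eq, sub_zero, abs_of_nonneg (hK0 _ y)] at this
        exact this.le
      linarith
  rw [integral_zero] at hGlim
  have hslln := ae_all_iff.2 fun M =>
    tendsto_average_of_iid hYmeas hYindep hYlaw (hGm M) (hGi M)
  filter_upwards [hslln, ae_all_of_law hYmeas hYlaw hKG] with ω hω hω2
  rw [Metric.tendsto_atTop]
  intro ε hε
  obtain ⟨M, hM⟩ := (hGlim.eventually (gt_mem_nhds hε)).exists
  obtain ⟨n₀, hn₀⟩ := eventually_atTop.1 (((hω M).eventually (gt_mem_nhds hM)).and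
    (hm.eventually_ge_atTop (M + 1)))
  refine ⟨n₀, fun n hn => ?_⟩
  obtain ⟨h1, h2⟩ := hn₀ n hn
  have hnn : 0 ≤ (∑ k ∈ Finset.range n, K (m n) (Y k ω)) / n :=
    div_nonneg (Finset.sum_nonneg fun k _ => hK0 _ _) (by positivity)
  rw [Real.dist_eq, sub_zero, abs_of_nonneg hnn]
  refine lt_of_le_of_lt ?_ h1
  gcongr with k _
  exact hω2 k M _ h2
end

/-! ### Products of characteristic functions -/

/-- In the unit disc `a - 1` has nonpositive real part, which bounds the exponential. Far from `1`
the estimate is then trivial, and near `1` it is the Taylor bound. -/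
lemma norm_sub_exp_sub_one_le {a : ℂ} (ha : ‖a‖ ≤ 1) :
    ‖a - Complex.exp (a - 1)‖ ≤ 2 * ‖a - 1‖ ^ 2 ∧ ‖Complex.exp (a - 1)‖ ≤ 1 := by
  have he : ‖Complex.exp (a - 1)‖ ≤ 1 := by
    rw [Complex.norm_exp, Real.exp_le_one_iff]
    have := (Complex.re_le_norm a).trans ha
    simpa using this
  refine ⟨?_, he⟩
  rcases le_total ‖a - 1‖ 1 with h | h
  · have := Complex.norm_exp_sub_one_sub_id_le h
    rw [← norm_neg]
    rw [show -(a - Complex.exp (a - 1)) = Complex.exp (a - 1) - 1 - (a - 1) by ring]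
    nlinarith [sq_nonneg ‖a - 1‖]
  · refine (norm_sub_le _ _).trans ?_
    nlinarith

/-- Telescoping between two products whose factors all lie in the unit disc. This replaces complex
logarithms of the characteristic functions. -/
lemma norm_prod_sub_exp_sum_le (n : ℕ) (a : ℕ → ℂ) (ha : ∀ k, ‖a k‖ ≤ 1) :
    ‖∏ k ∈ Finset.range n, a k - Complex.exp (∑ k ∈ Finset.range n, (a k - 1))‖ ≤
      2 * ∑ k ∈ Finset.range n, ‖a k - 1‖ ^ 2 := by
  induction n with
  | zero => simp
  | succ n ih =>
    rw [Finset.prod_range_succ, Finset.sum_range_succ, Finset.sum_range_succ, Complex.exp_add]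
    set p := ∏ k ∈ Finset.range n, a k
    set q := Complex.exp (∑ k ∈ Finset.range n, (a k - 1))
    have hp : ‖p‖ ≤ 1 := by
      rw [norm_prod]
      exact Finset.prod_le_one (fun _ _ => norm_nonneg _) fun k _ => ha k
    obtain ⟨h1, h2⟩ := norm_sub_exp_sub_one_le (ha n)
    rw [show p * a n - q * Complex.exp (a n - 1) =
      p * (a n - Complex.exp (a n - 1)) + (p - q) * Complex.exp (a n - 1) by ring]
    refine (norm_add_le _ _).trans ?_
    rw [norm_mul, norm_mul]
    have := mul_le_mul hp h1 (norm_nonneg _) zero_le_one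
    have := mul_le_mul ih h2 (norm_nonneg _) (by positivity)
    linarith

/-! ### The number of samples -/

lemma numSamples_pos {β : ℝ} (hβ : 0 < β) {T : ℕ} (hT : 0 < T) : 0 < numSamples β T :=
  Nat.ceil_pos.2 (mul_pos hβ (by exact_mod_cast hT))

lemma tendsto_numSamples {β : ℝ} (hβ : 0 < β) : Tendsto (numSamples β) atTop atTop :=
  tendsto_nat_ceil_atTop.comp (tendsto_natCast_atTop_atTop.const_mul_atTop hβ)

lemma tendsto_div_numSamples {β : ℝ} (hβ : 0 < β) :
    Tendsto (fun T : ℕ => (T : ℝ) / numSamples β T) atTop (𝓝 β⁻¹) := by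
  have h := (tendsto_nat_ceil_mul_div_atTop hβ.le).comp (tendsto_natCast_atTop_atTop (R := ℝ))
  have h2 := h.inv₀ hβ.ne'
  refine h2.congr fun T => ?_
  simp [numSamples]

/-! ### ### Convergence of the conditional characteristic functions -/

section
variable {E S : Type*} [MeasurableSpace E] [MeasurableSpace S] {γ : Measure E}
  [IsProbabilityMeasure γ] {w d : S → E → ℝ}

lemma measurable_normSum_uncurry {f : S → E → ℝ} (hf : Measurable (Function.uncurry f)) (N : ℕ) :
    Measurable fun z : S × (Fin N → E) => normSum (f z.1) z.2 := by
  unfold normSum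
  refine Measurable.const_mul (Finset.measurable_fun_sum _ fun i _ => ?_) _
  exact hf.comp (measurable_fst.prodMk ((measurable_pi_apply i).comp measurable_snd))

lemma measurable_blockAvg_uncurry {f : S → E → ℝ} (hf : Measurable (Function.uncurry f)) (N : ℕ) :
    Measurable fun z : S × (Fin N → E) => blockAvg (f z.1) z.2 := by
  unfold blockAvg
  refine Measurable.const_mul (Finset.measurable_fun_sum _ fun i _ => ?_) _
  exact hf.comp (measurable_fst.prodMk ((measurable_pi_apply i).comp measurable_snd))

lemma measurable_tiltErr (hw : Measurable (Function.uncurry w))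
    (hd : Measurable (Function.uncurry d)) (N : ℕ) :
    Measurable fun y => tiltErr γ (w y) (d y) N := by
  have h1 := measurable_normSum_uncurry hd N
  have h2 := measurable_normSum_uncurry (f := fun y x => w y x - 1) (hw.sub_const 1) N
  have h3 := measurable_blockAvg_uncurry hd N
  have h4 := measurable_blockAvg_uncurry hw N
  have : Measurable fun z : S × (Fin N → E) => (normSum (d z.1) z.2 ^ 2 +
      normSum (fun x => w z.1 x - 1) z.2 ^ 2) *
      (min 1 |blockAvg (w z.1) z.2 - 1| + min 1 |blockAvg (d z.1) z.2|) := by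
    fun_prop
  exact (this.stronglyMeasurable.integral_prod_right' (ν := Measure.pi fun _ : Fin N => γ)).measurable

lemma measurable_integral_sq (hd : Measurable (Function.uncurry d)) :
    Measurable fun y => ∫ x, d y x ^ 2 ∂γ :=
  ((hd.pow_const 2).stronglyMeasurable.integral_prod_right' (ν := γ)).measurable

lemma measurable_pairMoment (hw : Measurable (Function.uncurry w))
    (hd : Measurable (Function.uncurry d)) : Measurable fun y => pairMoment γ (w y) (d y) :=
  (measurable_integral_sq hd).add
    (measurable_integral_sq (d := fun y x => w y x - 1) (hw.sub_const 1))

variable {Ω : Type*} [MeasurableSpace Ω] {P : Measure Ω} {μ : Measure S} {Y : ℕ → Ω → S}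

/-- Given the data, the characteristic functions of the sum of the blocks converge to the Gaussian
one, almost surely and simultaneously in the argument. -/
theorem tendsto_prod_tiltChar (hYmeas : ∀ t, Measurable (Y t)) (hYindep : iIndepFun Y P)
    (hYlaw : ∀ t, P.map (Y t) = μ) (hw : Measurable (Function.uncurry w))
    (hd : Measurable (Function.uncurry d)) (hpair : ∀ᵐ y ∂μ, IsWeightPair γ (w y) (d y))
    (hH : Integrable (fun y => pairMoment γ (w y) (d y)) μ) {β : ℝ} (hβ : 0 < β) :
    ∀ᵐ ω ∂P, ∀ s : ℝ, Tendsto (fun T : ℕ => ∏ k ∈ Finset.range T,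
      tiltChar γ (w (Y k ω)) (d (Y k ω)) (numSamples β T) s) atTop
      (𝓝 (Complex.exp (-((s ^ 2 * (β⁻¹ * ∫ y, ∫ x, d y x ^ 2 ∂γ ∂μ) / 2 : ℝ) : ℂ)))) := by
  set H : S → ℝ := fun y => pairMoment γ (w y) (d y) with hHdef
  have hH0 : ∀ y, 0 ≤ H y := fun y => pairMoment_nonneg _ _
  have hHm : Measurable H := measurable_pairMoment hw hd
  set v : S → ℝ := fun y => ∫ x, d y x ^ 2 ∂γ with hvdef
  have hv0 : ∀ y, 0 ≤ v y := fun y => integral_nonneg fun _ => sq_nonneg _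
  have hvH : ∀ y, v y ≤ H y := fun y =>
    le_add_of_nonneg_right (integral_nonneg fun _ => sq_nonneg _)
  have hvm : Measurable v := measurable_integral_sq hd
  have hvi : Integrable v μ := hH.mono' hvm.aestronglyMeasurable
    (ae_of_all _ fun y => by rw [Real.norm_of_nonneg (hv0 y)]; exact hvH y)
  -- `N |φ - 1|` is at most a multiple of `H`, but `H²` need not be integrable. Combining the
  -- squared bound with `|φ - 1|² ≤ 2 |φ - 1|` gives the minimum, which `H` dominates and which
  -- tends to zero pointwise.
  set K : ℕ → S → ℝ := fun N y => min (H y) (H y ^ 2 / N) with hKdef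
  have hK0 : ∀ N y, 0 ≤ K N y := fun N y => le_min (hH0 y) (by positivity)
  have hTm := tendsto_numSamples hβ
  have A1 := tendsto_average_of_dominated hYmeas hYindep hYlaw (K := fun N y =>
    tiltErr γ (w y) (d y) N) (H := fun y => 2 * H y) (fun N => measurable_tiltErr hw hd N)
    (hH.const_mul 2) (fun N y => tiltErr_nonneg _ _ _)
    (by filter_upwards [hpair] with y hy N hN using hy.tiltErr_le hN)
    (by filter_upwards [hpair] with y hy using hy.tendsto_tiltErr) hTm
  have A2 := tendsto_average_of_dominated hYmeas hYindep hYlaw (K := K) (H := H)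
    (fun N => by fun_prop) hH hK0 (ae_of_all _ fun y N _ => min_le_left _ _)
    (ae_of_all _ fun y => by
      refine squeeze_zero (fun N => hK0 N y) (fun N => min_le_right _ _) ?_
      exact tendsto_const_nhds.div_atTop tendsto_natCast_atTop_atTop) hTm
  have A3 := tendsto_average_of_iid hYmeas hYindep hYlaw hvm hvi
  have hr := tendsto_div_numSamples hβ
  filter_upwards [A1, A2, A3, ae_all_of_law hYmeas hYlaw hpair] with ω h1 h2 h3 hp s
  set φ : ℕ → ℕ → ℂ := fun T k => tiltChar γ (w (Y k ω)) (d (Y k ω)) (numSamples β T) s with hφ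
  have hφ1 : ∀ T, 0 < T → ∀ k, ‖φ T k‖ ≤ 1 := fun T hT k =>
    (hp k).norm_tiltChar_le (numSamples_pos hβ hT) s
  have hexp : ∀ T, 0 < T → ∀ k, ‖(numSamples β T : ℂ) * (φ T k - 1) +
      (s : ℂ) ^ 2 * ((v (Y k ω) : ℝ) : ℂ) / 2‖ ≤
      tiltConst s * tiltErr γ (w (Y k ω)) (d (Y k ω)) (numSamples β T) := fun T hT k =>
    (hp k).norm_tiltChar_sub_le (numSamples_pos hβ hT) s
  have hs0 := tiltConst_nonneg s
  set c := 2 * tiltConst s + s ^ 2 with hc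
  have hc0 : 0 ≤ c := by positivity
  -- The constant adds up the two regimes of the minimum: `2 c` from `|φ - 1| ≤ 2`, and `c²` from
  -- squaring `N |φ - 1| ≤ c H`.
  have hsmall : ∀ T, 0 < T → ∀ k, ‖φ T k - 1‖ ^ 2 ≤
      (2 * c + c ^ 2) / numSamples β T * K (numSamples β T) (Y k ω) := by
    intro T hT k
    set N := numSamples β T
    have hN : (0 : ℝ) < N := by exact_mod_cast numSamples_pos hβ hT
    have hb : N * ‖φ T k - 1‖ ≤ c * H (Y k ω) := by
      have e : (N : ℝ) * ‖φ T k - 1‖ = ‖(N : ℂ) * (φ T k - 1)‖ := by simp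
      rw [e, show (N : ℂ) * (φ T k - 1) = ((N : ℂ) * (φ T k - 1) +
        (s : ℂ) ^ 2 * ((v (Y k ω) : ℝ) : ℂ) / 2) - (s : ℂ) ^ 2 * ((v (Y k ω) : ℝ) : ℂ) / 2 by ring]
      refine (norm_sub_le _ _).trans ?_
      have h5 : ‖(s : ℂ) ^ 2 * ((v (Y k ω) : ℝ) : ℂ) / 2‖ = s ^ 2 * v (Y k ω) / 2 := by
        simp [abs_of_nonneg (hv0 _)]
      rw [h5]
      have h6 := (hexp T hT k).trans (mul_le_mul_of_nonneg_left
        ((hp k).tiltErr_le (numSamples_pos hβ hT)) hs0)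
      have h7 := hvH (Y k ω)
      have h8 := hH0 (Y k ω)
      have h9 : s ^ 2 * v (Y k ω) / 2 ≤ s ^ 2 * H (Y k ω) := by
        nlinarith [sq_nonneg s, hv0 (Y k ω), mul_le_mul_of_nonneg_left h7 (sq_nonneg s)]
      rw [hc]
      change _ ≤ tiltConst s * (2 * H (Y k ω)) at h6
      linarith
    have hφ2 : ‖φ T k - 1‖ ≤ 2 := by
      refine (norm_sub_le _ _).trans ?_
      rw [norm_one]
      linarith [hφ1 T hT k]
    set x := ‖φ T k - 1‖
    have hx : 0 ≤ x := norm_nonneg _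
    rw [div_mul_eq_mul_div, le_div_iff₀ hN, hKdef]
    dsimp only
    rcases min_choice (H (Y k ω)) (H (Y k ω) ^ 2 / N) with h | h <;> rw [h]
    · nlinarith [mul_le_mul_of_nonneg_right hφ2 (mul_nonneg hx hN.le),
        mul_nonneg (sq_nonneg c) (hH0 (Y k ω))]
    · have : (N * x) ^ 2 ≤ (c * H (Y k ω)) ^ 2 := by gcongr
      have e : x ^ 2 * N = (N * x) ^ 2 / N := by field_simp
      have e2 : (2 * c + c ^ 2) * (H (Y k ω) ^ 2 / N) =
        (2 * c * H (Y k ω) ^ 2 + (c * H (Y k ω)) ^ 2) / N := by ring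
      rw [e, e2]
      gcongr
      nlinarith [mul_nonneg hc0 (sq_nonneg (H (Y k ω)))]
  -- Writing the sum as `N⁻¹ ∑ N (φ - 1)`, the main term is `T / N` times the empirical mean of `v`,
  -- and the error is `T / N` times the empirical mean of `tiltErr`.
  have hsum : Tendsto (fun T : ℕ => ∑ k ∈ Finset.range T, (φ T k - 1)) atTop
      (𝓝 (-((s ^ 2 * (β⁻¹ * ∫ y, v y ∂μ) / 2 : ℝ) : ℂ))) := by
    have hmain : Tendsto (fun T : ℕ => -((s ^ 2 * ((T : ℝ) / numSamples β T *
        ((∑ k ∈ Finset.range T, v (Y k ω)) / T)) / 2 : ℝ) : ℂ)) atTop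
        (𝓝 (-((s ^ 2 * (β⁻¹ * ∫ y, v y ∂μ) / 2 : ℝ) : ℂ))) := by
      refine Tendsto.neg ?_
      refine (Complex.continuous_ofReal.tendsto _).comp ?_
      exact ((hr.mul h3).const_mul _).div_const _
    have herr : Tendsto (fun T : ℕ => tiltConst s * ((T : ℝ) / numSamples β T *
        ((∑ k ∈ Finset.range T, tiltErr γ (w (Y k ω)) (d (Y k ω)) (numSamples β T)) / T)))
        atTop (𝓝 0) := by
      have := (hr.mul h1).const_mul (tiltConst s)
      simpa using this
    refine (tendsto_iff_of_dist ?_).2 hmain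
    refine squeeze_zero' (Eventually.of_forall fun T => dist_nonneg) ?_ herr
    filter_upwards [eventually_gt_atTop 0] with T hT
    have hN : (0 : ℝ) < numSamples β T := by exact_mod_cast numSamples_pos hβ hT
    have hT' : (0 : ℝ) < T := by exact_mod_cast hT
    have hNc : (numSamples β T : ℂ) ≠ 0 := by exact_mod_cast hN.ne'
    have hTc : (T : ℂ) ≠ 0 := by exact_mod_cast hT'.ne'
    rw [dist_eq_norm]
    have e : (∑ k ∈ Finset.range T, (φ T k - 1)) - -((s ^ 2 * ((T : ℝ) / numSamples β T *
        ((∑ k ∈ Finset.range T, v (Y k ω)) / T)) / 2 : ℝ) : ℂ) =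
        (numSamples β T : ℂ)⁻¹ * ∑ k ∈ Finset.range T, ((numSamples β T : ℂ) * (φ T k - 1) +
      (s : ℂ) ^ 2 * ((v (Y k ω) : ℝ) : ℂ) / 2) := by
      rw [Finset.sum_add_distrib, ← Finset.mul_sum, ← Finset.sum_div, ← Finset.mul_sum]
      push_cast
      field_simp
      ring
    rw [e, norm_mul, norm_inv]
    have e2 : tiltConst s * ((T : ℝ) / numSamples β T *
        ((∑ k ∈ Finset.range T, tiltErr γ (w (Y k ω)) (d (Y k ω)) (numSamples β T)) / T)) =
        ‖(numSamples β T : ℂ)‖⁻¹ * ∑ k ∈ Finset.range T, tiltConst s *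
          tiltErr γ (w (Y k ω)) (d (Y k ω)) (numSamples β T) := by
      rw [← Finset.mul_sum, Complex.norm_natCast]
      field_simp
    rw [e2]
    gcongr
    exact (norm_sum_le _ _).trans (Finset.sum_le_sum fun k _ => hexp T hT k)
  have hexpsum := (Complex.continuous_exp.tendsto _).comp hsum
  refine (tendsto_iff_of_dist ?_).2 hexpsum
  have herr : Tendsto (fun T : ℕ => 2 * (2 * c + c ^ 2) * ((T : ℝ) / numSamples β T *
      ((∑ k ∈ Finset.range T, K (numSamples β T) (Y k ω)) / T))) atTop (𝓝 0) := by
    have := (hr.mul h2).const_mul (2 * (2 * c + c ^ 2))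
    simpa using this
  refine squeeze_zero' (Eventually.of_forall fun T => dist_nonneg) ?_ herr
  filter_upwards [eventually_gt_atTop 0] with T hT
  have hT' : (0 : ℝ) < T := by exact_mod_cast hT
  rw [dist_eq_norm]
  refine (norm_prod_sub_exp_sum_le T (φ T) (hφ1 T hT)).trans ?_
  have e2 : 2 * (2 * c + c ^ 2) * ((T : ℝ) / numSamples β T *
      ((∑ k ∈ Finset.range T, K (numSamples β T) (Y k ω)) / T)) =
      2 * ∑ k ∈ Finset.range T, (2 * c + c ^ 2) / numSamples β T * K (numSamples β T) (Y k ω) := by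
    rw [← Finset.mul_sum]
    field_simp
  rw [e2]
  gcongr with k _
  exact hsmall T hT k
end

/-! ### The tilted block law -/

/-- The law on blocks of `N` variables with density `blockAvg w` with respect to `γ^N`. -/
noncomputable def tiltLaw {E : Type*} [MeasurableSpace E] (γ : Measure E) (w : E → ℝ) (N : ℕ) :
    Measure (Fin N → E) :=
  (Measure.pi fun _ : Fin N => γ).withDensity fun u => ENNReal.ofReal (blockAvg w u)

/-- On a box the indicator times the product density is a product of functions of single
coordinates, which are independent under `Measure.pi m`. -/
lemma pi_withDensity_eq {ι : Type*} [Fintype ι] {X : ι → Type*} [∀ i, MeasurableSpace (X i)]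
    (m : ∀ i, Measure (X i)) [∀ i, IsProbabilityMeasure (m i)] {g : ∀ i, X i → ENNReal}
    (hg : ∀ i, Measurable (g i)) [∀ i, IsProbabilityMeasure ((m i).withDensity (g i))] :
    Measure.pi (fun i => (m i).withDensity (g i)) =
      (Measure.pi m).withDensity fun x => ∏ i, g i (x i) := by
  refine Measure.pi_eq fun s hs => ?_
  rw [withDensity_apply _ (MeasurableSet.univ_pi hs), ← lintegral_indicator (MeasurableSet.univ_pi hs)]
  have e : (Set.univ.pi s).indicator (fun x : ∀ i, X i => ∏ i, g i (x i)) =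
      fun x => ∏ i, (s i).indicator (g i) (x i) := by
    ext x
    by_cases hx : x ∈ Set.univ.pi s
    · rw [Set.indicator_of_mem hx]
      exact Finset.prod_congr rfl fun i _ => (Set.indicator_of_mem (hx i trivial) _).symm
    · rw [Set.indicator_of_notMem hx]
      simp only [Set.mem_univ_pi, not_forall] at hx
      obtain ⟨i, hi⟩ := hx
      exact (Finset.prod_eq_zero (Finset.mem_univ i) (Set.indicator_of_notMem hi _)).symm
  rw [e, lintegral_prod_eq_prod_lintegral_of_indepFun Finset.univ
    (fun i (x : ∀ i, X i) => (s i).indicator (g i) (x i))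
    (iIndepFun_pi (μ := m) fun i => ((hg i).indicator (hs i)).aemeasurable)
    (fun i => ((hg i).indicator (hs i)).comp (measurable_pi_apply i))]
  refine Finset.prod_congr rfl fun i _ => ?_
  rw [withDensity_apply _ (hs i), ← lintegral_indicator (hs i)]
  exact (measurePreserving_eval m i).lintegral_comp ((hg i).indicator (hs i))

section
variable {E : Type*} [MeasurableSpace E] {γ : Measure E} {w f : E → ℝ} {N : ℕ}

lemma lintegral_tiltLaw (hw : Measurable w) {F : (Fin N → E) → ENNReal} (hF : Measurable F) :
    ∫⁻ u, F u ∂(tiltLaw γ w N) =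
      ∫⁻ u, F u * ENNReal.ofReal (blockAvg w u) ∂(Measure.pi fun _ => γ) := by
  rw [tiltLaw, lintegral_withDensity_eq_lintegral_mul _ (by fun_prop) hF]
  simp only [Pi.mul_apply, mul_comm]

lemma integral_tiltLaw {V : Type*} [NormedAddCommGroup V] [NormedSpace ℝ V] (hw : Measurable w)
    (hw0 : ∀ x, 0 ≤ w x) (F : (Fin N → E) → V) :
    ∫ u, F u ∂(tiltLaw γ w N) = ∫ u, blockAvg w u • F u ∂(Measure.pi fun _ => γ) := by
  have := integral_withDensity_eq_integral_smul (μ := Measure.pi fun _ : Fin N => γ)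
    (f := fun u : Fin N → E => (blockAvg w u).toNNReal) (by fun_prop) F
  rw [tiltLaw]
  refine this.trans ?_
  congr 1
  ext u
  rw [NNReal.smul_def, Real.coe_toNNReal _ (blockAvg_nonneg hw0 u)]

variable [IsProbabilityMeasure γ]

lemma isProbabilityMeasure_tiltLaw (hN : 0 < N) (hw0 : ∀ x, 0 ≤ w x) (hwi : Integrable w γ)
    (hw1 : ∫ x, w x ∂γ = 1) : IsProbabilityMeasure (tiltLaw γ w N) := by
  constructor
  rw [tiltLaw, withDensity_apply _ MeasurableSet.univ, Measure.restrict_univ,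
    ← ofReal_integral_eq_lintegral_ofReal
      (memLp_one_iff_integrable.1 (memLp_blockAvg (memLp_one_iff_integrable.2 hwi)))
      (ae_of_all _ fun u => blockAvg_nonneg hw0 u), integral_blockAvg hN hwi, hw1]
  simp

/-! ### Second moments from weighted moments of a normalized sum -/

/-- For centred `f` a shift adds `r²` to the second moment. Extended integrals are used since square
integrability of `f` is what is to be derived; otherwise the right side is infinite. -/
lemma lintegral_sq_le_lintegral_add_sq (hf : Measurable f) (hfi : Integrable f γ)
    (h0 : ∫ x, f x ∂γ = 0) (r : ℝ) :
    ∫⁻ x, ENNReal.ofReal (f x ^ 2) ∂γ ≤ ∫⁻ x, ENNReal.ofReal ((f x + r) ^ 2) ∂γ := by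
  by_cases h : Integrable (fun x => (f x + r) ^ 2) γ
  · have h2 : MemLp (fun x => f x + r) 2 γ :=
      (memLp_two_iff_integrable_sq (by fun_prop)).2 h
    have h3 : MemLp f 2 γ := (h2.sub (memLp_const r)).ae_eq (ae_of_all _ fun x => by simp)
    rw [← ofReal_integral_eq_lintegral_ofReal h3.integrable_sq (ae_of_all _ fun x => sq_nonneg _),
      ← ofReal_integral_eq_lintegral_ofReal h (ae_of_all _ fun x => sq_nonneg _)]
    refine ENNReal.ofReal_le_ofReal ?_
    have e : ∫ x, (f x + r) ^ 2 ∂γ = ∫ x, (f x ^ 2 + 2 * r * f x + r ^ 2) ∂γ := by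
      congr 1; ext x; ring
    have hsq := h3.integrable_sq
    rw [e, integral_add (by fun_prop) (by fun_prop), integral_add (by fun_prop) (by fun_prop),
      integral_const_mul, h0]
    simp [sq_nonneg]
  · have : ∫⁻ x, ENNReal.ofReal ((f x + r) ^ 2) ∂γ = ⊤ := by
      by_contra hne
      refine h ⟨by fun_prop, ?_⟩
      rw [hasFiniteIntegral_iff_ofReal (ae_of_all _ fun x => sq_nonneg _)]
      exact lt_top_iff_ne_top.2 hne
    rw [this]
    exact le_top

/-- Coordinate `0` is integrated first: the other summands act as a constant shift, which cannot
lower the second moment. The weight sits on coordinate `1`, hence is untouched and integrates to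
one; this is why two draws are required. -/
lemma lintegral_sq_le_lintegral_sum_sq_mul {n : ℕ} (hw : Measurable w) (hw0 : ∀ x, 0 ≤ w x)
    (hwi : Integrable w γ) (hw1 : ∫ x, w x ∂γ = 1) (hf : Measurable f) (hfi : Integrable f γ)
    (h0 : ∫ x, f x ∂γ = 0) :
    ∫⁻ x, ENNReal.ofReal (f x ^ 2) ∂γ ≤
      ∫⁻ u : Fin (n + 2) → E, ENNReal.ofReal ((∑ i, f (u i)) ^ 2) * ENNReal.ofReal (w (u 1))
        ∂(Measure.pi fun _ => γ) := by
  have hmp := measurePreserving_piFinSuccAbove (fun _ : Fin (n + 2) => γ) 0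
  set G : E × (Fin (n + 1) → E) → ENNReal := fun z =>
    ENNReal.ofReal ((f z.1 + ∑ i, f (z.2 i)) ^ 2) * ENNReal.ofReal (w (z.2 0)) with hG
  have hGm : Measurable G := by fun_prop
  have e : ∫⁻ u : Fin (n + 2) → E, ENNReal.ofReal ((∑ i, f (u i)) ^ 2) * ENNReal.ofReal (w (u 1))
        ∂(Measure.pi fun _ => γ) = ∫⁻ z, G z ∂(γ.prod (Measure.pi fun _ => γ)) := by
    refine Eq.trans ?_ (hmp.lintegral_comp hGm)
    refine lintegral_congr fun u => ?_
    simp only [hG, MeasurableEquiv.piFinSuccAbove_apply, Fin.insertNthEquiv_symm_apply,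
      Fin.sum_univ_succ (n := n + 1)]
    rfl
  rw [e, lintegral_prod_symm _ hGm.aemeasurable]
  have h1 : ∫⁻ u : Fin (n + 1) → E, ENNReal.ofReal (w (u 0)) ∂(Measure.pi fun _ => γ) = 1 := by
    rw [(measurePreserving_eval (fun _ : Fin (n + 1) => γ) 0).lintegral_comp
      (f := fun x => ENNReal.ofReal (w x)) (by fun_prop),
      ← ofReal_integral_eq_lintegral_ofReal hwi (ae_of_all _ hw0), hw1, ENNReal.ofReal_one]
  calc ∫⁻ x, ENNReal.ofReal (f x ^ 2) ∂γ
      = ∫⁻ u : Fin (n + 1) → E, (∫⁻ x, ENNReal.ofReal (f x ^ 2) ∂γ) * ENNReal.ofReal (w (u 0))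
          ∂(Measure.pi fun _ => γ) := by
        rw [lintegral_const_mul _ (by fun_prop), h1, mul_one]
    _ ≤ _ := by
        refine lintegral_mono fun u => ?_
        simp only [hG]
        rw [lintegral_mul_const _ (by fun_prop)]
        exact mul_le_mul' (lintegral_sq_le_lintegral_add_sq hf hfi h0 _) le_rfl

/-- A single weight is at most `N * blockAvg w`, and `z² ≤ 1 + z⁴`. The crude factor `N²` is
harmless, as only finiteness at one `N` is needed. -/
lemma lintegral_sq_le_of_fourth (hN : 2 ≤ N) (hw : Measurable w) (hw0 : ∀ x, 0 ≤ w x)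
    (hwi : Integrable w γ) (hw1 : ∫ x, w x ∂γ = 1) (hf : Measurable f) (hfi : Integrable f γ)
    (h0 : ∫ x, f x ∂γ = 0) :
    ∫⁻ x, ENNReal.ofReal (f x ^ 2) ∂γ ≤ ENNReal.ofReal (N ^ 2) *
      (1 + ∫⁻ u, ENNReal.ofReal (normSum f u ^ 4) ∂(tiltLaw γ w N)) := by
  have := isProbabilityMeasure_tiltLaw (N := N) (by omega) hw0 hwi hw1
  obtain ⟨n, rfl⟩ : ∃ n, N = n + 2 := ⟨N - 2, by omega⟩
  refine (lintegral_sq_le_lintegral_sum_sq_mul (n := n) hw hw0 hwi hw1 hf hfi h0).trans ?_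
  have hN' : (0 : ℝ) < ((n + 2 : ℕ) : ℝ) := by positivity
  calc _ ≤ ∫⁻ u : Fin (n + 2) → E, ENNReal.ofReal (((n + 2 : ℕ) : ℝ) ^ 2) *
          (ENNReal.ofReal (1 + normSum f u ^ 4) * ENNReal.ofReal (blockAvg w u))
          ∂(Measure.pi fun _ => γ) := by
        refine lintegral_mono fun u => ?_
        rw [← ENNReal.ofReal_mul (by positivity), ← ENNReal.ofReal_mul (by positivity),
          ← ENNReal.ofReal_mul (by positivity)]
        refine ENNReal.ofReal_le_ofReal ?_
        have h1 : w (u 1) ≤ ((n + 2 : ℕ) : ℝ) * blockAvg w u := by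
          unfold blockAvg
          rw [← mul_assoc, mul_one_div_cancel hN'.ne', one_mul]
          exact Finset.single_le_sum (fun i _ => hw0 (u i)) (Finset.mem_univ (1 : Fin (n + 2)))
        have h2 : (∑ i, f (u i)) ^ 2 = ((n + 2 : ℕ) : ℝ) * normSum f u ^ 2 := by
          unfold normSum
          rw [mul_pow, div_pow, Real.sq_sqrt hN'.le]
          field_simp
        have h3 : normSum f u ^ 2 ≤ 1 + normSum f u ^ 4 := by
          nlinarith [sq_nonneg (normSum f u ^ 2 - 1), sq_nonneg (normSum f u ^ 2)]
        have h4 := blockAvg_nonneg hw0 u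
        calc (∑ i, f (u i)) ^ 2 * w (u 1)
            ≤ ((n + 2 : ℕ) : ℝ) * (1 + normSum f u ^ 4) * (((n + 2 : ℕ) : ℝ) * blockAvg w u) := by
              rw [h2]
              gcongr
              exact hw0 _
          _ = _ := by ring
    _ = _ := by
        have hm : Measurable fun u : Fin (n + 2) → E => ENNReal.ofReal (1 + normSum f u ^ 4) := by
          fun_prop
        rw [lintegral_const_mul _ (by fun_prop), ← lintegral_tiltLaw hw hm]
        congr 1
        have : ∀ u : Fin (n + 2) → E, ENNReal.ofReal (1 + normSum f u ^ 4) =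
            1 + ENNReal.ofReal (normSum f u ^ 4) := fun u => by
          rw [ENNReal.ofReal_add zero_le_one (by positivity), ENNReal.ofReal_one]
        simp only [this]
        rw [lintegral_add_left measurable_const]
        simp

end

/-! ### Conditional laws of functions of the data and the auxiliary variables -/

section
variable {Ω A B : Type*} [MeasurableSpace Ω] [MeasurableSpace A] [MeasurableSpace B]
  [StandardBorelSpace B] [Nonempty B] {P : Measure Ω} [IsProbabilityMeasure P] {X : Ω → A}
  {V : Ω → B}

lemma lintegral_eq_lintegral_condDistrib (hX : Measurable X) (hV : AEMeasurable V P)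
    {m : Ω → Measure B} (hm : ∀ᵐ ω ∂P, condDistrib V X P (X ω) = m ω) {F : A × B → ENNReal}
    (hF : Measurable F) :
    ∫⁻ ω, F (X ω, V ω) ∂P = ∫⁻ ω, ∫⁻ b, F (X ω, b) ∂(m ω) ∂P := by
  rw [← lintegral_map' hF.aemeasurable (hX.aemeasurable.prodMk hV),
    ← compProd_map_condDistrib hV, Measure.lintegral_compProd hF,
    lintegral_map (hF.lintegral_kernel_prod_right') hX]
  refine lintegral_congr_ae ?_
  filter_upwards [hm] with ω hω
  rw [hω]

/-- The image kernel disintegrates the joint law of `X` and `R`, and disintegrations are almost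
surely unique. Almost sure equality with `Z` suffices, so `R` itself may lack a measurable formula.
-/
lemma condDistrib_comp_prodMk (hX : Measurable X) (hV : AEMeasurable V P) {Z : A × B → ℝ}
    (hZ : Measurable Z) {R : Ω → ℝ} (hR : R =ᵐ[P] fun ω => Z (X ω, V ω)) :
    ∀ᵐ ω ∂P, condDistrib R X P (X ω) = (condDistrib V X P (X ω)).map fun b => Z (X ω, b) := by
  set κ := condDistrib V X P
  set η : Kernel A ℝ := (Kernel.id ×ₖ κ).map Z with hη
  have hηa : ∀ a, η a = (κ a).map fun b => Z (a, b) := fun a => by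
    rw [hη, Kernel.map_apply _ hZ, Kernel.prod_apply, Kernel.id_apply, Measure.dirac_prod,
      Measure.map_map hZ (by fun_prop)]
    rfl
  have : IsMarkovKernel η := Kernel.IsMarkovKernel.map _ hZ
  have hZV : AEMeasurable (fun ω => Z (X ω, V ω)) P :=
    hZ.comp_aemeasurable (hX.aemeasurable.prodMk hV)
  have hkey : P.map (fun ω => (X ω, R ω)) = P.map X ⊗ₘ η := by
    have : P.map (fun ω => (X ω, R ω)) = P.map (fun ω => (X ω, Z (X ω, V ω))) := by
      refine Measure.map_congr ?_
      filter_upwards [hR] with ω hω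
      rw [hω]
    rw [this]
    refine Measure.ext_of_lintegral _ fun F hF => ?_
    rw [lintegral_map' hF.aemeasurable (hX.aemeasurable.prodMk hZV), Measure.lintegral_compProd hF,
      lintegral_map (hF.lintegral_kernel_prod_right') hX,
      lintegral_eq_lintegral_condDistrib hX hV (m := fun ω => κ (X ω)) (ae_of_all _ fun _ => rfl)
        (F := fun z => F (z.1, Z z)) (by fun_prop)]
    refine lintegral_congr fun ω => ?_
    rw [hηa, lintegral_map (by fun_prop) (by fun_prop)]
  have h := condDistrib_ae_eq_of_measure_eq_compProd X (hZV.congr hR.symm) hkey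
  filter_upwards [ae_of_ae_map hX.aemeasurable h] with ω hω
  rw [hω, hηa]
end

/-! ### Sums over independent tilted blocks -/

section
variable {E : Type*} [MeasurableSpace E] {γ : Measure E}

/-- The score error of a single block. -/
noncomputable def blockScore {N : ℕ} (w d : E → ℝ) (u : Fin N → E) : ℝ :=
  blockAvg d u / blockAvg w u

variable {w d : E → ℝ} {N : ℕ}

lemma IsWeightPair.measurable_blockScore (h : IsWeightPair γ w d) :
    Measurable (blockScore (N := N) w d) := by
  have := h.measurable_w; have := h.measurable_d
  unfold blockScore; fun_prop

lemma IsWeightPair.integral_exp_blockScore (h : IsWeightPair γ w d) (s : ℝ) :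
    ∫ u, Complex.exp (s * (blockScore w d u : ℂ) * Complex.I) ∂(tiltLaw γ w N) =
      tiltChar γ w d N s := by
  rw [integral_tiltLaw h.measurable_w h.nonneg, tiltChar]
  congr 1
  ext u
  rw [Complex.real_smul]
  congr 2
  rw [blockScore]
  push_cast
  ring

lemma lintegral_eval_tiltLaw {T : ℕ} {wk : Fin T → E → ℝ}
    (h : ∀ k, IsProbabilityMeasure (tiltLaw γ (wk k) N)) {k : Fin T} (hw : Measurable (wk k)) {F : (Fin N → E) → ENNReal} (hF : Measurable F) :
    ∫⁻ u, F (u k) ∂(Measure.pi fun k => tiltLaw γ (wk k) N) =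
      ∫⁻ u, F u * ENNReal.ofReal (blockAvg (wk k) u) ∂(Measure.pi fun _ => γ) := by
  rw [(measurePreserving_eval (fun k => tiltLaw γ (wk k) N) k).lintegral_comp hF,
    lintegral_tiltLaw hw hF]

variable [IsProbabilityMeasure γ]

lemma IsWeightPair.isProbabilityMeasure_tiltLaw (h : IsWeightPair γ w d) (hN : 0 < N) :
    IsProbabilityMeasure (tiltLaw γ w N) :=
  _root_.isProbabilityMeasure_tiltLaw hN h.nonneg (h.memLp_w.integrable one_le_two) h.integral_w

/-- The content is the case of a vanishing denominator, where Lean's quotient is `0`: a zero average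
of nonnegative weights makes every weight zero, hence every gradient zero. -/
lemma blockAvg_mul_blockScore_ae (h : IsWeightPair γ w d) (hz : ∀ᵐ x ∂γ, w x = 0 → d x = 0) :
    ∀ᵐ u ∂(Measure.pi fun _ : Fin N => γ), blockAvg w u * blockScore w d u = blockAvg d u := by
  have hall : ∀ᵐ u ∂(Measure.pi fun _ : Fin N => γ), ∀ i, w (u i) = 0 → d (u i) = 0 :=
    ae_all_iff.2 fun i =>
      (Measure.quasiMeasurePreserving_eval (fun _ : Fin N => γ) i).ae hz
  filter_upwards [hall] with u hu
  unfold blockScore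
  by_cases hW : blockAvg w u = 0
  · rw [hW, zero_mul]
    symm
    rcases Nat.eq_zero_or_pos N with rfl | hN
    · simp [blockAvg]
    have hN' : (0 : ℝ) < N := by exact_mod_cast hN
    have h1 : ∑ i, w (u i) = 0 := by
      unfold blockAvg at hW
      rcases mul_eq_zero.1 hW with h' | h'
      · exact absurd h' (by positivity)
      · exact h'
    have h2 := (Finset.sum_eq_zero_iff_of_nonneg fun i _ => h.nonneg (u i)).1 h1
    unfold blockAvg
    rw [Finset.sum_eq_zero fun i hi => hu i (h2 i hi), mul_zero]
  · field_simp

lemma IsWeightPair.integrable_blockScore (h : IsWeightPair γ w d)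
    (hz : ∀ᵐ x ∂γ, w x = 0 → d x = 0) :
    Integrable (blockScore (N := N) w d) (tiltLaw γ w N) := by
  have hm : Measurable fun u : Fin N → E => (blockAvg w u).toNNReal :=
    (measurable_blockAvg h.measurable_w).real_toNNReal
  have := (integrable_withDensity_iff_integrable_smul (μ := Measure.pi fun _ : Fin N => γ) hm
    (g := blockScore (N := N) w d)).2 ?_
  · exact this
  · refine (h.integrable_d_avg (N := N)).congr ?_
    filter_upwards [blockAvg_mul_blockScore_ae h hz] with u hu
    rw [NNReal.smul_def, Real.coe_toNNReal _ (blockAvg_nonneg h.nonneg u), smul_eq_mul, hu]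

/-- The tilting density cancels the denominator and leaves the untilted mean of `blockAvg d`. This
is the exact unbiasedness of each score. -/
lemma IsWeightPair.integral_blockScore (h : IsWeightPair γ w d)
    (hz : ∀ᵐ x ∂γ, w x = 0 → d x = 0) (hN : 0 < N) :
    ∫ u, blockScore w d u ∂(tiltLaw γ w N) = 0 := by
  rw [integral_tiltLaw h.measurable_w h.nonneg]
  refine (integral_congr_ae (blockAvg_mul_blockScore_ae h hz)).trans ?_
  rw [integral_blockAvg hN (h.memLp_d.integrable one_le_two), h.integral_d]

variable {T : ℕ} {wk dk : Fin T → E → ℝ}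

/-- Independence of the blocks. The alternative `T = 0` in `hN` covers the empty sample, for which
`numSamples` is zero and there is no block to normalize. -/
lemma charFun_map_sum_blockScore (h : ∀ k, IsWeightPair γ (wk k) (dk k)) (hN : T = 0 ∨ 0 < N)
    (s : ℝ) :
    charFun ((Measure.pi fun k => tiltLaw γ (wk k) N).map
      fun u => ∑ k, blockScore (wk k) (dk k) (u k)) s = ∏ k, tiltChar γ (wk k) (dk k) N s := by
  have : ∀ k, IsProbabilityMeasure (tiltLaw γ (wk k) N) := fun k =>
    (h k).isProbabilityMeasure_tiltLaw (hN.resolve_left (by have := k.2; omega))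
  have hm : Measurable fun u : Fin T → Fin N → E => ∑ k, blockScore (wk k) (dk k) (u k) :=
    Finset.measurable_fun_sum _ fun k _ =>
      (h k).measurable_blockScore.comp (measurable_pi_apply k)
  rw [charFun_apply_real, integral_map hm.aemeasurable
    (Measurable.aestronglyMeasurable (by fun_prop))]
  simp only [← (h _).integral_exp_blockScore]
  rw [← integral_fintype_prod_eq_prod (fun k u =>
    Complex.exp (s * (blockScore (wk k) (dk k) u : ℂ) * Complex.I))]
  congr 1
  ext u
  rw [← Complex.exp_sum]
  congr 1
  push_cast
  rw [Finset.mul_sum, Finset.sum_mul]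

lemma integral_sum_blockScore (h : ∀ k, IsWeightPair γ (wk k) (dk k))
    (hz : ∀ k, ∀ᵐ x ∂γ, wk k x = 0 → dk k x = 0) (hN : T = 0 ∨ 0 < N) :
    ∫ u, ∑ k, blockScore (wk k) (dk k) (u k) ∂(Measure.pi fun k => tiltLaw γ (wk k) N) = 0 := by
  have hN' : ∀ _ : Fin T, 0 < N := fun k => hN.resolve_left (by have := k.2; omega)
  have : ∀ k, IsProbabilityMeasure (tiltLaw γ (wk k) N) := fun k =>
    (h k).isProbabilityMeasure_tiltLaw (hN' k)
  rw [integral_finsetSum _ fun k _ => integrable_comp_eval (μ := fun k => tiltLaw γ (wk k) N)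
    ((h k).integrable_blockScore (hz k))]
  refine Finset.sum_eq_zero fun k _ => ?_
  rw [integral_comp_eval (μ := fun k => tiltLaw γ (wk k) N)
    (h k).measurable_blockScore.aestronglyMeasurable]
  exact (h k).integral_blockScore (hz k) (hN' k)

end

namespace LatentVariableModel

variable {n p : ℕ} {S : Type*} [MeasurableSpace S] {ν : Measure S} {Θ : Set ℝ}
  (M : LatentVariableModel n p S ν Θ)

/-! ### Normalized weights of the model -/

lemma measurable_lik {t : ℝ} (ht : t ∈ Θ) : Measurable (M.lik t) := by
  have h : Measurable fun z : S × EuclideanSpace ℝ (Fin n) => M.f t z.2 * M.g t z.1 z.2 :=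
    ((M.f_measurable t ht).comp measurable_snd).mul (M.g_measurable t ht)
  exact (h.stronglyMeasurable.integral_prod_right' (ν := volume)).measurable

lemma lik_nonneg {t : ℝ} (ht : t ∈ Θ) (y : S) : 0 ≤ M.lik t y :=
  integral_nonneg fun x => mul_nonneg (M.f_nonneg t ht x) (M.g_nonneg t ht y x)

lemma weight_nonneg {t : ℝ} (ht : t ∈ Θ) (y : S) (u : EuclideanSpace ℝ (Fin p)) :
    0 ≤ M.weight t y u :=
  div_nonneg (mul_nonneg (M.g_nonneg t ht y _) (M.f_nonneg t ht _)) (M.q_nonneg t ht y _)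

lemma measurable_nweight {t : ℝ} (ht : t ∈ Θ) :
    Measurable fun z : S × EuclideanSpace ℝ (Fin p) => M.nweight t z.1 z.2 := by
  have hγ := M.γ_measurable t ht
  have h1 : Measurable fun z : S × EuclideanSpace ℝ (Fin p) => (z.1, M.γ t z.1 z.2) :=
    measurable_fst.prodMk hγ
  exact ((((M.g_measurable t ht).comp h1).mul ((M.f_measurable t ht).comp hγ)).div
    ((M.q_measurable t ht).comp h1)).div ((M.measurable_lik ht).comp measurable_fst)

lemma nweight_nonneg {t : ℝ} (ht : t ∈ Θ) (y : S) (u : EuclideanSpace ℝ (Fin p)) :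
    0 ≤ M.nweight t y u :=
  div_nonneg (M.weight_nonneg ht y u) (M.lik_nonneg ht y)

/-- The importance sampling identity, by change of variables along `γ`. Where `q` vanishes, both
sides are zero almost everywhere by `q_support`. -/
lemma integral_weight {t : ℝ} (ht : t ∈ Θ) (y : S) :
    ∫ u, M.weight t y u ∂(stdGaussian (EuclideanSpace ℝ (Fin p))) = M.lik t y := by
  have hy : Measurable fun x : EuclideanSpace ℝ (Fin n) => (y, x) := measurable_prodMk_left
  have hg : Measurable (M.g t y) := (M.g_measurable t ht).comp hy
  have hq : Measurable (M.q t y) := (M.q_measurable t ht).comp hy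
  have hγ : Measurable (M.γ t y) := (M.γ_measurable t ht).comp measurable_prodMk_left
  have hf := M.f_measurable t ht
  have hF : Measurable fun x => M.g t y x * M.f t x / M.q t y x := (hg.mul hf).div hq
  calc ∫ u, M.weight t y u ∂(stdGaussian (EuclideanSpace ℝ (Fin p)))
      = ∫ x, M.g t y x * M.f t x / M.q t y x
          ∂((stdGaussian (EuclideanSpace ℝ (Fin p))).map (M.γ t y)) :=
        (integral_map hγ.aemeasurable hF.aestronglyMeasurable).symm
    _ = ∫ x, (M.q t y x).toNNReal • (M.g t y x * M.f t x / M.q t y x) := by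
        rw [M.γ_law t ht y]
        exact integral_withDensity_eq_integral_smul hq.real_toNNReal _
    _ = M.lik t y := by
        refine integral_congr_ae ?_
        filter_upwards [M.q_support t ht y] with x hx
        rw [NNReal.smul_def, Real.coe_toNNReal _ (M.q_nonneg t ht y x), smul_eq_mul]
        by_cases h : M.q t y x = 0
        · rw [hx h, h, zero_mul]
        · field_simp

lemma integral_nweight {t : ℝ} (ht : t ∈ Θ) {y : S} (hy : 0 < M.lik t y) :
    ∫ u, M.nweight t y u ∂(stdGaussian (EuclideanSpace ℝ (Fin p))) = 1 := by
  unfold nweight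
  rw [integral_div, M.integral_weight ht, div_self hy.ne']

/-- A nonintegrable function would have integral `0` by convention, not `1`. -/
lemma integrable_nweight {t : ℝ} (ht : t ∈ Θ) {y : S} (hy : 0 < M.lik t y) :
    Integrable (M.nweight t y) (stdGaussian (EuclideanSpace ℝ (Fin p))) := by
  by_contra h
  have := M.integral_nweight ht hy
  rw [integral_undef h] at this
  exact zero_ne_one this

lemma likEst_div_lik {N : ℕ} (t : ℝ) (y : S) (u : Fin N → EuclideanSpace ℝ (Fin p)) :
    M.likEst t y u / M.lik t y = blockAvg (M.nweight t y) u := by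
  unfold likEst blockAvg nweight
  rw [mul_div_assoc, Finset.sum_div]

lemma fullLikEst_div_fullLik {T N : ℕ} (t : ℝ) (y : Fin T → S)
    (u : Fin T → Fin N → EuclideanSpace ℝ (Fin p)) :
    M.fullLikEst t y u / M.fullLik t y = ∏ k, blockAvg (M.nweight t (y k)) (u k) := by
  unfold fullLikEst fullLik
  rw [← Finset.prod_div_distrib]
  simp only [likEst_div_lik]

lemma auxLaw_eq_pi {T N : ℕ} {t : ℝ} (ht : t ∈ Θ) (y : Fin T → S)
    (h : ∀ k, IsProbabilityMeasure
      (tiltLaw (stdGaussian (EuclideanSpace ℝ (Fin p))) (M.nweight t (y k)) N)) :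
    M.auxLaw N t y = Measure.pi fun k =>
      tiltLaw (stdGaussian (EuclideanSpace ℝ (Fin p))) (M.nweight t (y k)) N := by
  have hm : ∀ k, Measurable fun u : Fin N → EuclideanSpace ℝ (Fin p) =>
      ENNReal.ofReal (blockAvg (M.nweight t (y k)) u) := fun k =>
    (measurable_blockAvg ((M.measurable_nweight ht).comp measurable_prodMk_left)).ennreal_ofReal
  unfold tiltLaw at h ⊢
  rw [pi_withDensity_eq _ hm, auxLaw]
  congr 1
  ext u
  rw [M.fullLikEst_div_fullLik, ENNReal.ofReal_prod_of_nonneg]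
  exact fun k _ => blockAvg_nonneg (M.nweight_nonneg ht (y k)) (u k)

/-! ### Derivatives -/

/-- Weights are nonnegative for parameters near the interior point `θ`, so a zero weight is a local
minimum. -/
lemma gradNweight_eq_zero {θ : ℝ} (hθ : θ ∈ interior Θ) {y : S} {u : EuclideanSpace ℝ (Fin p)}
    (h : M.nweight θ y u = 0) : M.gradNweight θ y u = 0 := by
  refine IsLocalMin.deriv_eq_zero ?_
  filter_upwards [mem_interior_iff_mem_nhds.1 hθ] with t ht
  rw [h]
  exact M.nweight_nonneg ht y u

/-- The gradient is an almost everywhere limit of difference quotients along one fixed sequence of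
steps, each quotient being jointly measurable. The factor `ε / 2` keeps `θ + h j` inside `Θ`. -/
lemma aemeasurable_gradNweight {θ : ℝ} (hθ : θ ∈ interior Θ)
    {m : Measure (S × EuclideanSpace ℝ (Fin p))}
    (hdiff : ∀ᵐ z ∂m, DifferentiableAt ℝ (fun t => M.nweight t z.1 z.2) θ) :
    AEMeasurable (fun z : S × EuclideanSpace ℝ (Fin p) => M.gradNweight θ z.1 z.2) m := by
  obtain ⟨ε, hε, hball⟩ := Metric.mem_nhds_iff.1 (mem_interior_iff_mem_nhds.1 hθ)
  set h : ℕ → ℝ := fun j => ε / 2 * (1 / ((j : ℝ) + 1)) with hh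
  have hpos : ∀ j, 0 < h j := fun j => by positivity
  have hmem : ∀ j, θ + h j ∈ Θ := fun j => by
    refine hball ?_
    rw [Metric.mem_ball, Real.dist_eq, add_sub_cancel_left, abs_of_pos (hpos j), hh]
    have : 1 / ((j : ℝ) + 1) ≤ 1 := by
      rw [div_le_one (by positivity)]
      linarith [(Nat.cast_nonneg j : (0 : ℝ) ≤ j)]
    dsimp only
    nlinarith
  have hlim : Tendsto h atTop (𝓝[≠] 0) := by
    refine tendsto_nhdsWithin_iff.2 ⟨?_, Eventually.of_forall fun j => (hpos j).ne'⟩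
    simpa [hh] using (tendsto_one_div_add_atTop_nhds_zero_nat (𝕜 := ℝ)).const_mul (ε / 2)
  refine aemeasurable_of_tendsto_metrizable_ae atTop (f := fun j z =>
    (h j)⁻¹ • (M.nweight (θ + h j) z.1 z.2 - M.nweight θ z.1 z.2)) (fun j => ?_) ?_
  · exact (((M.measurable_nweight (hmem j)).sub
      (M.measurable_nweight (interior_subset hθ))).const_mul (h j)⁻¹).aemeasurable
  · filter_upwards [hdiff] with z hz
    exact (hasDerivAt_iff_tendsto_slope_zero.1 hz.hasDerivAt).comp hlim

lemma hasDerivAt_blockAvg {N : ℕ} {θ : ℝ} {y : S} {u : Fin N → EuclideanSpace ℝ (Fin p)}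
    (hu : ∀ i, DifferentiableAt ℝ (fun t => M.nweight t y (u i)) θ) :
    HasDerivAt (fun t => blockAvg (M.nweight t y) u) (blockAvg (M.gradNweight θ y) u) θ := by
  unfold blockAvg
  exact (HasDerivAt.fun_sum fun i _ => (hu i).hasDerivAt).const_mul _

lemma gradEps_eq_normSum {N : ℕ} {θ : ℝ} {y : S} {u : Fin N → EuclideanSpace ℝ (Fin p)}
    (hu : ∀ i, DifferentiableAt ℝ (fun t => M.nweight t y (u i)) θ) :
    M.gradEps θ y u = normSum (M.gradNweight θ y) u := by
  unfold gradEps eps normSum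
  exact ((HasDerivAt.fun_sum fun i _ => (hu i).hasDerivAt.sub_const 1).const_mul _).deriv

lemma gradLogError_eq_sum {T N : ℕ} {θ : ℝ} {y : Fin T → S}
    {u : Fin T → Fin N → EuclideanSpace ℝ (Fin p)}
    (hu : ∀ k i, DifferentiableAt ℝ (fun t => M.nweight t (y k) (u k i)) θ)
    (hpos : ∀ k, 0 < blockAvg (M.nweight θ (y k)) (u k)) :
    M.gradLogError θ y u = ∑ k, blockScore (M.nweight θ (y k)) (M.gradNweight θ (y k)) (u k) := by
  unfold gradLogError
  simp only [fullLikEst_div_fullLik]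
  have hd : ∀ k, HasDerivAt (fun t => blockAvg (M.nweight t (y k)) (u k))
      (blockAvg (M.gradNweight θ (y k)) (u k)) θ := fun k => M.hasDerivAt_blockAvg (hu k)
  have hne : ∏ k, blockAvg (M.nweight θ (y k)) (u k) ≠ 0 :=
    Finset.prod_ne_zero_iff.2 fun k _ => (hpos k).ne'
  have h := logDeriv_prod (s := Finset.univ) (f := fun k t => blockAvg (M.nweight t (y k)) (u k))
    (x := θ) (fun k _ => (hpos k).ne') (fun k _ => (hd k).differentiableAt)
  have hdp : DifferentiableAt ℝ (fun t => ∏ k, blockAvg (M.nweight t (y k)) (u k)) θ :=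
    DifferentiableAt.fun_finsetProd fun k _ => (hd k).differentiableAt
  rw [deriv.log hdp hne]
  simp only [logDeriv_apply, (hd _).deriv] at h
  rw [h]
  rfl

end LatentVariableModel

lemma measurable_obs {Ω S : Type*} [MeasurableSpace Ω] [MeasurableSpace S] {Y : ℕ → Ω → S}
    (hY : ∀ t, Measurable (Y t)) (T : ℕ) : Measurable (obs Y T) :=
  measurable_pi_lambda _ fun k => hY k

/-! ### ### Square integrability from one fourth moment -/

section
variable {E S : Type*} [MeasurableSpace E] [MeasurableSpace S] {γ : Measure E}
  [IsProbabilityMeasure γ] {μ : Measure S} [IsProbabilityMeasure μ] {w f : S → E → ℝ}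

lemma integrable_sq_of_fourth {N : ℕ} (hN : 2 ≤ N) (hw : Measurable (Function.uncurry w))
    (hf : Measurable (Function.uncurry f)) (hw0 : ∀ y x, 0 ≤ w y x)
    (hw1 : ∀ᵐ y ∂μ, Integrable (w y) γ ∧ ∫ x, w y x ∂γ = 1)
    (hf0 : ∀ᵐ y ∂μ, Integrable (f y) γ ∧ ∫ x, f y x ∂γ = 0)
    (h4 : ∫⁻ y, ∫⁻ u : Fin N → E, ENNReal.ofReal (normSum (f y) u ^ 4) *
      ENNReal.ofReal (blockAvg (w y) u) ∂(Measure.pi fun _ => γ) ∂μ < ⊤) :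
    Integrable (fun z : S × E => f z.1 z.2 ^ 2) (μ.prod γ) := by
  have hm : Measurable fun z : S × E => f z.1 z.2 ^ 2 := hf.pow_const 2
  refine ⟨hm.aestronglyMeasurable, ?_⟩
  rw [hasFiniteIntegral_iff_ofReal (ae_of_all _ fun z => sq_nonneg _),
    lintegral_prod _ hm.ennreal_ofReal.aemeasurable]
  have hle : ∀ᵐ y ∂μ, ∫⁻ x, ENNReal.ofReal (f y x ^ 2) ∂γ ≤ ENNReal.ofReal (N ^ 2) *
      (1 + ∫⁻ u : Fin N → E, ENNReal.ofReal (normSum (f y) u ^ 4) *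
      ENNReal.ofReal (blockAvg (w y) u) ∂(Measure.pi fun _ => γ)) := by
    filter_upwards [hw1, hf0] with y h1 h2
    have hwy : Measurable (w y) := hw.comp measurable_prodMk_left
    have hfy : Measurable (f y) := hf.comp measurable_prodMk_left
    have := lintegral_sq_le_of_fourth hN hwy (hw0 y) h1.1 h1.2 hfy h2.1 h2.2
    rwa [lintegral_tiltLaw hwy (by fun_prop)] at this
  refine (lintegral_mono_ae hle).trans_lt ?_
  rw [lintegral_const_mul' _ _ ENNReal.ofReal_ne_top, lintegral_add_left measurable_const]
  refine ENNReal.mul_lt_top ENNReal.ofReal_lt_top ?_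
  simpa using h4

end

/-! ### ### Joint law of an observation and its auxiliary block -/

namespace LatentVariableModel

variable {n p : ℕ} {S : Type*} [MeasurableSpace S] {ν : Measure S} {Θ : Set ℝ}
  (M : LatentVariableModel n p S ν Θ)

section
variable {θ : ℝ} {μ : Measure S} {Ω : Type*} [MeasurableSpace Ω]
  {P : Measure Ω} [IsProbabilityMeasure P] {Y : ℕ → Ω → S} {T N : ℕ}
  {V : Ω → Fin T → Fin N → EuclideanSpace ℝ (Fin p)}

lemma isProbabilityMeasure_tiltLaw_nweight (hθ : θ ∈ Θ) (hN : 0 < N) {y : S}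
    (hy : 0 < M.lik θ y) : IsProbabilityMeasure
      (tiltLaw (stdGaussian (EuclideanSpace ℝ (Fin p))) (M.nweight θ y) N) :=
  isProbabilityMeasure_tiltLaw hN (M.nweight_nonneg hθ y) (M.integrable_nweight hθ hy)
    (M.integral_nweight hθ hy)

/-- The joint law of one observation and its block of auxiliary variables. -/
lemma lintegral_block (hθ : θ ∈ Θ) (hlik : ∀ᵐ y ∂μ, 0 < M.lik θ y)
    (hYmeas : ∀ t, Measurable (Y t)) (hYlaw : ∀ t, P.map (Y t) = μ) (hV : AEMeasurable V P)
    (hVlaw : ∀ᵐ ω ∂P, condDistrib V (obs Y T) P (obs Y T ω) = M.auxLaw N θ (obs Y T ω))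
    (hN : 0 < N) (k : Fin T) {F : S × (Fin N → EuclideanSpace ℝ (Fin p)) → ENNReal}
    (hF : Measurable F) :
    ∫⁻ ω, F (Y k ω, V ω k) ∂P = ∫⁻ y, ∫⁻ u, F (y, u) * ENNReal.ofReal (blockAvg (M.nweight θ y) u)
      ∂(Measure.pi fun _ => stdGaussian (EuclideanSpace ℝ (Fin p))) ∂μ := by
  have hw := M.measurable_nweight hθ
  have hb := measurable_blockAvg_uncurry (f := M.nweight θ) hw N
  have hG : Measurable fun z : (Fin T → S) × (Fin T → Fin N → EuclideanSpace ℝ (Fin p)) =>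
      F (z.1 k, z.2 k) := hF.comp (((measurable_pi_apply k).comp measurable_fst).prodMk
        ((measurable_pi_apply k).comp measurable_snd))
  have h1 := lintegral_eq_lintegral_condDistrib (measurable_obs hYmeas T) hV hVlaw hG
  refine h1.trans ?_
  have hin : Measurable fun y => ∫⁻ u, F (y, u) * ENNReal.ofReal (blockAvg (M.nweight θ y) u)
      ∂(Measure.pi fun _ : Fin N => stdGaussian (EuclideanSpace ℝ (Fin p))) :=
    (hF.mul hb.ennreal_ofReal).lintegral_prod_right'
  rw [← hYlaw k, lintegral_map hin (hYmeas k)]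
  refine lintegral_congr_ae ?_
  filter_upwards [ae_all_of_law hYmeas hYlaw hlik] with ω hω
  have hp : ∀ j, IsProbabilityMeasure (tiltLaw (stdGaussian (EuclideanSpace ℝ (Fin p)))
      (M.nweight θ (obs Y T ω j)) N) := fun j =>
    M.isProbabilityMeasure_tiltLaw_nweight hθ hN (hω j)
  rw [M.auxLaw_eq_pi hθ _ hp]
  exact lintegral_eval_tiltLaw hp (k := k) (hw.comp measurable_prodMk_left)
    (F := fun u => F (obs Y T ω k, u)) (hF.comp measurable_prodMk_left)

/-- The joint law of an observation and its block has density `blockAvg` with respect to the product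
law. Null sets of the product therefore stay null, and the set where the density vanishes is not
charged; this legitimates the logarithmic derivative. -/
lemma ae_block [SFinite μ] (hθ : θ ∈ Θ) (hlik : ∀ᵐ y ∂μ, 0 < M.lik θ y)
    (hYmeas : ∀ t, Measurable (Y t)) (hYlaw : ∀ t, P.map (Y t) = μ) (hV : AEMeasurable V P)
    (hVlaw : ∀ᵐ ω ∂P, condDistrib V (obs Y T) P (obs Y T ω) = M.auxLaw N θ (obs Y T ω))
    (hN : T = 0 ∨ 0 < N) {q : S × EuclideanSpace ℝ (Fin p) → Prop}
    (hq : ∀ᵐ z ∂(μ.prod (stdGaussian (EuclideanSpace ℝ (Fin p)))), q z) :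
    ∀ᵐ ω ∂P, ∀ k : Fin T, (∀ i, q (Y k ω, V ω k i)) ∧
      0 < blockAvg (M.nweight θ (Y k ω)) (V ω k) := by
  obtain ⟨A, hA, hAm, hAq⟩ := hq.exists_measurable_mem
  refine ae_all_iff.2 fun k => ?_
  have hN' : 0 < N := hN.resolve_left (by have := k.2; omega)
  have hb := measurable_blockAvg_uncurry (f := M.nweight θ) (M.measurable_nweight hθ) N
  set C : Set (S × (Fin N → EuclideanSpace ℝ (Fin p))) :=
    {z | (∀ i, (z.1, z.2 i) ∈ A) ∧ 0 < blockAvg (M.nweight θ z.1) z.2} with hC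
  have hCm : MeasurableSet C := by
    have e : C = (⋂ i, (fun z : S × (Fin N → EuclideanSpace ℝ (Fin p)) => (z.1, z.2 i)) ⁻¹' A) ∩
        {z | 0 < blockAvg (M.nweight θ z.1) z.2} := by
      ext z; simp [hC]
    rw [e]
    refine MeasurableSet.inter (MeasurableSet.iInter fun i => ?_)
      (measurableSet_lt measurable_const hb)
    exact hAm.preimage (measurable_fst.prodMk ((measurable_pi_apply i).comp measurable_snd))
  have hFm : Measurable (Cᶜ.indicator (fun _ => (1 : ENNReal))) :=
    measurable_const.indicator hCm.compl
  have h := M.lintegral_block hθ hlik hYmeas hYlaw hV hVlaw hN' k hFm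
  have h0 : ∫⁻ y, ∫⁻ u, Cᶜ.indicator (fun _ => (1 : ENNReal)) (y, u) *
      ENNReal.ofReal (blockAvg (M.nweight θ y) u)
      ∂(Measure.pi fun _ => stdGaussian (EuclideanSpace ℝ (Fin p))) ∂μ = 0 := by
    refine (lintegral_congr_ae ?_).trans lintegral_zero
    filter_upwards [Measure.ae_ae_of_ae_prod hA] with y hy
    refine (lintegral_congr_ae ?_).trans lintegral_zero
    have hall : ∀ᵐ u ∂(Measure.pi fun _ : Fin N => stdGaussian (EuclideanSpace ℝ (Fin p))),
        ∀ i, (y, u i) ∈ A := ae_all_iff.2 fun i => (Measure.quasiMeasurePreserving_eval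
          (fun _ : Fin N => stdGaussian (EuclideanSpace ℝ (Fin p))) i).ae hy
    filter_upwards [hall] with u hu
    by_cases hpos : 0 < blockAvg (M.nweight θ y) u
    · have : (y, u) ∈ C := ⟨hu, hpos⟩
      simp [this]
    · rw [ENNReal.ofReal_of_nonpos (not_lt.1 hpos), mul_zero]
  have hFV : AEMeasurable (fun ω => Cᶜ.indicator (fun _ => (1 : ENNReal)) (Y k ω, V ω k)) P :=
    hFm.comp_aemeasurable ((hYmeas k).aemeasurable.prodMk
      ((measurable_pi_apply k).comp_aemeasurable hV))
  rw [h0, lintegral_eq_zero_iff' hFV] at h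
  filter_upwards [h] with ω hω
  have hmem : (Y k ω, V ω k) ∈ C := by
    by_contra hc
    simp [hc] at hω
  exact ⟨fun i => hAq _ (hmem.1 i), hmem.2⟩

end

end LatentVariableModel

namespace LatentVariableModel
variable {n p : ℕ} {S : Type*} [MeasurableSpace S] {ν : Measure S} {Θ : Set ℝ}
  (M : LatentVariableModel n p S ν Θ)
variable {θ : ℝ} {μ : Measure S} {Ω : Type*} [MeasurableSpace Ω]
  {P : Measure Ω} [IsProbabilityMeasure P] {Y : ℕ → Ω → S} {T N : ℕ}
  {V : Ω → Fin T → Fin N → EuclideanSpace ℝ (Fin p)}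

/-- Under the tilt `E|D / W|` becomes the untilted `E|D|`, bounded by `1 + E[d²]`, which is
integrable over the data. -/
lemma integrable_blockScore_comp (hθ : θ ∈ Θ) (hlik : ∀ᵐ y ∂μ, 0 < M.lik θ y)
    (hYmeas : ∀ t, Measurable (Y t)) (hYlaw : ∀ t, P.map (Y t) = μ) (hV : AEMeasurable V P)
    (hVlaw : ∀ᵐ ω ∂P, condDistrib V (obs Y T) P (obs Y T ω) = M.auxLaw N θ (obs Y T ω))
    (hN : 0 < N) (k : Fin T) {d : S → EuclideanSpace ℝ (Fin p) → ℝ}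
    (hd : Measurable (Function.uncurry d))
    (hpair : ∀ᵐ y ∂μ, IsWeightPair (stdGaussian (EuclideanSpace ℝ (Fin p))) (M.nweight θ y) (d y))
    (hz : ∀ᵐ y ∂μ, ∀ᵐ x ∂(stdGaussian (EuclideanSpace ℝ (Fin p))), M.nweight θ y x = 0 → d y x = 0)
    (hd2 : Integrable (fun y => ∫ x, d y x ^ 2 ∂(stdGaussian (EuclideanSpace ℝ (Fin p)))) μ)
    [IsFiniteMeasure μ] :
    Integrable (fun ω => blockScore (M.nweight θ (Y k ω)) (d (Y k ω)) (V ω k)) P := by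
  have hQ : Measurable fun z : S × (Fin N → EuclideanSpace ℝ (Fin p)) =>
      blockScore (M.nweight θ z.1) (d z.1) z.2 :=
    (measurable_blockAvg_uncurry hd N).div
      (measurable_blockAvg_uncurry (f := M.nweight θ) (M.measurable_nweight hθ) N)
  refine ⟨(hQ.comp_aemeasurable ((hYmeas k).aemeasurable.prodMk
      ((measurable_pi_apply k).comp_aemeasurable hV))).aestronglyMeasurable, ?_⟩
  rw [HasFiniteIntegral, M.lintegral_block hθ hlik hYmeas hYlaw hV hVlaw hN k hQ.enorm]
  have hb : ∀ᵐ y ∂μ, ∫⁻ u, ‖blockScore (M.nweight θ y) (d y) u‖ₑ *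
      ENNReal.ofReal (blockAvg (M.nweight θ y) u)
      ∂(Measure.pi fun _ : Fin N => stdGaussian (EuclideanSpace ℝ (Fin p))) ≤
      ENNReal.ofReal (1 + ∫ x, d y x ^ 2 ∂(stdGaussian (EuclideanSpace ℝ (Fin p)))) := by
    filter_upwards [hpair, hz] with y hy hzy
    calc _ = ∫⁻ u, ENNReal.ofReal |blockAvg (d y) u|
        ∂(Measure.pi fun _ : Fin N => stdGaussian (EuclideanSpace ℝ (Fin p))) := by
          refine lintegral_congr_ae ?_
          filter_upwards [blockAvg_mul_blockScore_ae (N := N) hy hzy] with u hu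
          rw [← hu, abs_mul, abs_of_nonneg (blockAvg_nonneg hy.nonneg u),
            Real.enorm_eq_ofReal_abs, ← ENNReal.ofReal_mul (abs_nonneg _), mul_comm]
      _ = ENNReal.ofReal (∫ u, |blockAvg (d y) u|
        ∂(Measure.pi fun _ : Fin N => stdGaussian (EuclideanSpace ℝ (Fin p)))) :=
          (ofReal_integral_eq_lintegral_ofReal hy.integrable_d_avg.abs
            (ae_of_all _ fun _ => abs_nonneg _)).symm
      _ ≤ _ := by
          refine ENNReal.ofReal_le_ofReal ((IsWeightPair.integral_abs_blockAvg_le hN hy.memLp_d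
            hy.integral_d).trans (div_le_self ?_ ?_))
          · exact add_nonneg zero_le_one (integral_nonneg fun _ => sq_nonneg _)
          · rw [Real.one_le_sqrt]; exact_mod_cast hN
  refine (lintegral_mono_ae hb).trans_lt ?_
  have hi : Integrable (fun y => 1 + ∫ x, d y x ^ 2 ∂(stdGaussian (EuclideanSpace ℝ (Fin p)))) μ :=
    (integrable_const _).add hd2
  exact hi.lintegral_lt_top

end LatentVariableModel

/-! ### ### The main theorem -/

set_option maxHeartbeats 1000000 in
theorem proposition3
    {n p : ℕ} {S : Type*} [MeasurableSpace S] {ν : Measure S} {Θ : Set ℝ}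
    (M : LatentVariableModel n p S ν Θ)
    -- the fixed parameter value, the scaling constant, the law of the data
    (θ : ℝ) (hθ : θ ∈ interior Θ) (β : ℝ) (hβ : 0 < β)
    (μ : Measure S) [IsProbabilityMeasure μ]
    -- `0 < p(y | t) < ∞` near `θ` (a non-integrable integrand would give the value `0`)
    (hpos : ∀ᵐ y ∂μ, ∀ᶠ t in 𝓝 θ, 0 < M.lik t y)
    -- `ϖ` has a gradient in the parameter, and derivative and expectation can be swapped
    (hdiff : ∀ᵐ z ∂(μ.prod (stdGaussian (EuclideanSpace ℝ (Fin p)))),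
      DifferentiableAt ℝ (fun t => M.nweight t z.1 z.2) θ)
    (hswap : ∀ᵐ y ∂μ,
      Integrable (fun u => M.gradNweight θ y u) (stdGaussian (EuclideanSpace ℝ (Fin p))) ∧
      HasDerivAt (fun t => ∫ u, M.nweight t y u ∂(stdGaussian (EuclideanSpace ℝ (Fin p))))
        (∫ u, M.gradNweight θ y u ∂(stdGaussian (EuclideanSpace ℝ (Fin p)))) θ)
    -- i.i.d. data, and auxiliary variables with conditional law `π̄(· | θ)` given `Y_{1:T}`
    {Ω : Type*} [MeasurableSpace Ω] (P : Measure Ω) [IsProbabilityMeasure P]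
    (Y : ℕ → Ω → S) (hYmeas : ∀ t, Measurable (Y t))
    (hYindep : iIndepFun Y P) (hYlaw : ∀ t, P.map (Y t) = μ)
    (U : ∀ T : ℕ, Ω → Fin T → Fin (numSamples β T) → EuclideanSpace ℝ (Fin p))
    (hUmeas : ∀ T, AEMeasurable (U T) P)
    (hUlaw : ∀ T, ∀ᵐ ω ∂P,
      condDistrib (U T) (obs Y T) P (obs Y T ω) = M.auxLaw (numSamples β T) θ (obs Y T ω))
    -- the moment conditions, on the last block of the array with `T + 1` observations
    (hgrad : limsup (fun T : ℕ => ∫⁻ ω, ENNReal.ofReal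
      (M.gradEps θ (Y T ω) (U (T + 1) ω (Fin.last T)) ^ 4) ∂P) atTop < ⊤)
    (heps : limsup (fun T : ℕ => ∫⁻ ω, ENNReal.ofReal
      (M.eps θ (Y T ω) (U (T + 1) ω (Fin.last T)) ^ 4) ∂P) atTop < ⊤) :
    -- the limiting variance is finite
    Integrable (fun z => M.gradNweight θ z.1 z.2 ^ 2)
      (μ.prod (stdGaussian (EuclideanSpace ℝ (Fin p)))) ∧
    -- the error is a random variable, and given `Y_{1:T}` it is asymptotically normal
    (∀ T, AEMeasurable (fun ω => M.gradLogError θ (obs Y T ω) (U T ω)) P) ∧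
    (∀ᵐ ω ∂P, Tendsto (β := ProbabilityMeasure ℝ)
      (fun T : ℕ => ⟨condDistrib (fun ω' => M.gradLogError θ (obs Y T ω') (U T ω')) (obs Y T) P
          (obs Y T ω), inferInstance⟩)
      atTop
      (𝓝 ⟨gaussianReal 0 (Real.toNNReal (β⁻¹ *
          ∫ z, M.gradNweight θ z.1 z.2 ^ 2 ∂(μ.prod (stdGaussian (EuclideanSpace ℝ (Fin p)))))),
        inferInstance⟩)) ∧
    -- the conditional bias is asymptotically zero
    (∀ T, Integrable (fun ω => M.gradLogError θ (obs Y T ω) (U T ω)) P) ∧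
    (∀ᵐ ω ∂P, Tendsto
      (fun T : ℕ => (P[fun ω' => M.gradLogError θ (obs Y T ω') (U T ω') |
        MeasurableSpace.comap (obs Y T) inferInstance]) ω)
      atTop (𝓝 0)) := by
  have hθΘ : θ ∈ Θ := interior_subset hθ
  set γ := stdGaussian (EuclideanSpace ℝ (Fin p)) with hγ
  have hwm : Measurable (Function.uncurry (M.nweight θ)) := M.measurable_nweight hθΘ
  have hN : ∀ T, T = 0 ∨ 0 < numSamples β T := fun T =>
    (Nat.eq_zero_or_pos T).imp_right fun h => numSamples_pos hβ h
  have hgm := M.aemeasurable_gradNweight hθ hdiff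
  -- A jointly measurable version of the gradient; all integrals and kernels below are built from
  -- it.
  obtain ⟨d, hdm, hdeq⟩ : ∃ d : S → EuclideanSpace ℝ (Fin p) → ℝ, Measurable (Function.uncurry d) ∧
      ∀ᵐ z ∂(μ.prod γ), M.gradNweight θ z.1 z.2 = d z.1 z.2 :=
    ⟨fun y x => hgm.mk _ (y, x), hgm.measurable_mk, by exact hgm.ae_eq_mk⟩
  have hdeq' := Measure.ae_ae_of_ae_prod hdeq
  have hlik : ∀ᵐ y ∂μ, 0 < M.lik θ y := by
    filter_upwards [hpos] with y hy using hy.self_of_nhds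
  have hw1 : ∀ᵐ y ∂μ, Integrable (M.nweight θ y) γ ∧ ∫ x, M.nweight θ y x ∂γ = 1 := by
    filter_upwards [hlik] with y hy
    exact ⟨M.integrable_nweight hθΘ hy, M.integral_nweight hθΘ hy⟩
  have hd0 : ∀ᵐ y ∂μ, Integrable (d y) γ ∧ ∫ x, d y x ∂γ = 0 := by
    filter_upwards [hpos, hswap, hdeq'] with y hy hs he
    refine ⟨hs.1.congr he, ?_⟩
    rw [← integral_congr_ae he]
    -- The normalized weight has mean one throughout a neighbourhood of `θ`, so the swapped
    -- derivative must be zero.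
    have hconst : (fun t => ∫ u, M.nweight t y u ∂γ) =ᶠ[𝓝 θ] fun _ => (1 : ℝ) := by
      filter_upwards [hy, mem_interior_iff_mem_nhds.1 hθ] with t h1 h2
      exact M.integral_nweight h2 h1
    exact hs.2.unique ((hasDerivAt_const θ (1 : ℝ)).congr_of_eventuallyEq hconst)
  have hz : ∀ᵐ y ∂μ, ∀ᵐ x ∂γ, M.nweight θ y x = 0 → d y x = 0 := by
    filter_upwards [hdeq'] with y hy
    filter_upwards [hy] with x hx h0
    rw [← hx]
    exact M.gradNweight_eq_zero hθ h0
  have hblock := fun T => M.ae_block hθΘ hlik hYmeas hYlaw (hUmeas T) (hUlaw T) (hN T)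
    (hdiff.and hdeq)
  -- Finite limsups are used at one index only: both fourth moments are finite there and the block
  -- of the array with `T₀ + 1` rows has at least two draws.
  obtain ⟨T₀, ⟨hT1, hT2⟩, hT3⟩ := (((eventually_lt_of_limsup_lt hgrad).and
    (eventually_lt_of_limsup_lt heps)).and
    (((tendsto_numSamples hβ).comp (tendsto_add_atTop_nat 1)).eventually_ge_atTop 2)).exists
  dsimp only [Function.comp] at hT3
  have hfin : ∀ f : S → EuclideanSpace ℝ (Fin p) → ℝ, Measurable (Function.uncurry f) →
      ∫⁻ ω, ENNReal.ofReal (normSum (f (Y T₀ ω)) (U (T₀ + 1) ω (Fin.last T₀)) ^ 4) ∂P < ⊤ →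
      ∫⁻ y, ∫⁻ u : Fin (numSamples β (T₀ + 1)) → EuclideanSpace ℝ (Fin p),
        ENNReal.ofReal (normSum (f y) u ^ 4) *
        ENNReal.ofReal (blockAvg (M.nweight θ y) u) ∂(Measure.pi fun _ => γ) ∂μ < ⊤ :=
    fun f hf hlt => by
      have := M.lintegral_block hθΘ hlik hYmeas hYlaw (hUmeas (T₀ + 1)) (hUlaw (T₀ + 1))
        (by omega) (Fin.last T₀) (F := fun z => ENNReal.ofReal (normSum (f z.1) z.2 ^ 4))
        ((measurable_normSum_uncurry hf _).pow_const 4).ennreal_ofReal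
      rw [← this]
      exact hlt
  have hi1 : Integrable (fun z : S × EuclideanSpace ℝ (Fin p) => d z.1 z.2 ^ 2) (μ.prod γ) := by
    refine integrable_sq_of_fourth hT3 hwm hdm (M.nweight_nonneg hθΘ) hw1 hd0
      (hfin d hdm (lt_of_eq_of_lt (lintegral_congr_ae ?_) hT1))
    filter_upwards [hblock (T₀ + 1)] with ω hω
    have h := (hω (Fin.last T₀)).1
    rw [Fin.val_last] at h
    rw [M.gradEps_eq_normSum fun i => (h i).1]
    unfold normSum
    congr 4
    exact funext fun i => (h i).2.symm
  have hi2 : Integrable (fun z : S × EuclideanSpace ℝ (Fin p) => (M.nweight θ z.1 z.2 - 1) ^ 2)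
      (μ.prod γ) := by
    refine integrable_sq_of_fourth (f := fun y x => M.nweight θ y x - 1) hT3 hwm (hwm.sub_const 1)
      (M.nweight_nonneg hθΘ) hw1 ?_ (hfin _ (hwm.sub_const 1) hT2)
    filter_upwards [hw1] with y hy
    refine ⟨hy.1.sub (integrable_const _), ?_⟩
    rw [integral_sub hy.1 (integrable_const _), hy.2]
    simp
  have hpair : ∀ᵐ y ∂μ, IsWeightPair γ (M.nweight θ y) (d y) := by
    filter_upwards [hw1, hd0, hi1.prod_right_ae, hi2.prod_right_ae] with y h1 h2 h3 h4
    have hwy : Measurable (M.nweight θ y) := hwm.comp measurable_prodMk_left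
    have hdy : Measurable (d y) := hdm.comp measurable_prodMk_left
    refine ⟨hwy, hdy, M.nweight_nonneg hθΘ y, ?_,
      (memLp_two_iff_integrable_sq hdy.aestronglyMeasurable).2 h3, h1.2, h2.2⟩
    have h5 : MemLp (fun x => M.nweight θ y x - 1) 2 γ :=
      (memLp_two_iff_integrable_sq (hwy.sub_const 1).aestronglyMeasurable).2 h4
    exact (h5.add (memLp_const 1)).ae_eq (ae_of_all _ fun x => by simp)
  have hd2 : Integrable (fun y => ∫ x, d y x ^ 2 ∂γ) μ := hi1.integral_prod_left
  have hH : Integrable (fun y => pairMoment γ (M.nweight θ y) (d y)) μ :=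
    hd2.add hi2.integral_prod_left
  have hvar : ∫ z, M.gradNweight θ z.1 z.2 ^ 2 ∂(μ.prod γ) = ∫ y, ∫ x, d y x ^ 2 ∂γ ∂μ := by
    rw [← integral_prod _ hi1]
    refine integral_congr_ae ?_
    filter_upwards [hdeq] with z h
    rw [h]
  have hR : ∀ T, (fun ω => M.gradLogError θ (obs Y T ω) (U T ω)) =ᵐ[P] fun ω =>
      ∑ k : Fin T, blockScore (M.nweight θ (Y k ω)) (d (Y k ω)) (U T ω k) := fun T => by
    filter_upwards [hblock T] with ω hω
    rw [M.gradLogError_eq_sum (y := obs Y T ω) (fun k i => ((hω k).1 i).1) fun k => (hω k).2]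
    refine Finset.sum_congr rfl fun k _ => ?_
    unfold blockScore
    congr 1
    unfold blockAvg
    congr 1
    exact Finset.sum_congr rfl fun i _ => ((hω k).1 i).2
  have hint : ∀ T, Integrable (fun ω => M.gradLogError θ (obs Y T ω) (U T ω)) P := fun T => by
    refine Integrable.congr (integrable_finsetSum _ fun k _ => ?_) (hR T).symm
    exact M.integrable_blockScore_comp hθΘ hlik hYmeas hYlaw (hUmeas T) (hUlaw T)
      ((hN T).resolve_left (by have := k.2; omega)) k hdm hpair hz hd2
  have hZm : ∀ T, Measurable fun z : (Fin T → S) × (Fin T → Fin (numSamples β T) →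
      EuclideanSpace ℝ (Fin p)) =>
      ∑ k, blockScore (M.nweight θ (z.1 k)) (d (z.1 k)) (z.2 k) := fun T => by
    refine Finset.measurable_fun_sum _ fun k _ => ?_
    have hk : Measurable fun z : (Fin T → S) × (Fin T → Fin (numSamples β T) →
      EuclideanSpace ℝ (Fin p)) => (z.1 k, z.2 k) :=
      ((measurable_pi_apply k).comp measurable_fst).prodMk
        ((measurable_pi_apply k).comp measurable_snd)
    exact ((measurable_blockAvg_uncurry hdm _).comp hk).div
      ((measurable_blockAvg_uncurry hwm _).comp hk)
  have hpairY := ae_all_of_law hYmeas hYlaw hpair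
  -- Outside one null set and for all `T` at once, the conditional law is that of a sum over
  -- independent tilted blocks.
  have hcond : ∀ᵐ ω ∂P, ∀ T, condDistrib (fun ω' => M.gradLogError θ (obs Y T ω') (U T ω'))
      (obs Y T) P (obs Y T ω) =
      (Measure.pi fun k : Fin T => tiltLaw γ (M.nweight θ (Y k ω)) (numSamples β T)).map
        fun u => ∑ k : Fin T, blockScore (M.nweight θ (Y k ω)) (d (Y k ω)) (u k) := by
    refine ae_all_iff.2 fun T => ?_
    filter_upwards [condDistrib_comp_prodMk (measurable_obs hYmeas T) (hUmeas T) (hZm T) (hR T),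
      hUlaw T, hpairY] with ω h1 h2 h3
    have hp : ∀ k, IsProbabilityMeasure (tiltLaw γ (M.nweight θ (obs Y T ω k)) (numSamples β T)) :=
      fun k => (h3 k).isProbabilityMeasure_tiltLaw
        ((hN T).resolve_left (by have := k.2; omega))
    rw [h1, h2, M.auxLaw_eq_pi hθΘ _ hp]
    rfl
  refine ⟨hi1.congr ?_, fun T => (hint T).aestronglyMeasurable.aemeasurable, ?_, hint, ?_⟩
  · filter_upwards [hdeq] with z h
    rw [h]
  · filter_upwards [hcond, hpairY, tendsto_prod_tiltChar hYmeas hYindep hYlaw hwm hdm hpair hH hβ]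
      with ω h1 h2 h3
    -- Lévy's theorem applies for fixed `ω` because the exceptional null set does not depend on `s`.
    refine ProbabilityMeasure.tendsto_iff_tendsto_charFun.2 fun s => ?_
    simp only [ProbabilityMeasure.coe_mk]
    have h0 : 0 ≤ β⁻¹ * ∫ z, M.gradNweight θ z.1 z.2 ^ 2 ∂(μ.prod γ) :=
      mul_nonneg (inv_nonneg.2 hβ.le) (integral_nonneg fun _ => sq_nonneg _)
    rw [charFun_gaussianReal]
    convert h3 s using 2 with T
    · rw [h1 T, charFun_map_sum_blockScore (fun k => h2 k) (hN T),
        Fin.prod_univ_eq_prod_range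
          (fun k => tiltChar γ (M.nweight θ (Y k ω)) (d (Y k ω)) (numSamples β T) s)]
    · congr 1
      rw [Real.coe_toNNReal _ h0, hvar]
      push_cast
      ring
  · have hzero : ∀ᵐ ω ∂P, ∀ T, (P[fun ω' => M.gradLogError θ (obs Y T ω') (U T ω') |
        MeasurableSpace.comap (obs Y T) inferInstance]) ω = 0 := by
      refine ae_all_iff.2 fun T => ?_
      filter_upwards [condExp_ae_eq_integral_condDistrib' (measurable_obs hYmeas T) (hint T), hcond,
        hpairY, ae_all_of_law hYmeas hYlaw hz] with ω h1 h2 h3 h4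
      rw [h1, h2 T, integral_map]
      · exact integral_sum_blockScore (fun k => h3 k) (fun k => h4 k) (hN T)
      · exact (Finset.measurable_fun_sum _ fun (k : Fin T) _ =>
          (h3 k).measurable_blockScore.comp (measurable_pi_apply k)).aemeasurable
      · exact measurable_id.aestronglyMeasurable
    filter_upwards [hzero] with ω hω
    simp only [hω]
    exact tendsto_const_nhds
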